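/- **Setting.** Let $H=(V,F)$ be a finite hypergraph: $V$ is a finite set and $F$ a set of non-empty subsets of $V$; $d_i=|\{\alpha\in F: i\in\alpha\}|$. An exponential family with base measure $\nu$ and sufficient statistic $\phi$ (with values in $\mathbb R^n$) consists of the densities $p_\theta=\exp(\langle\theta,\phi\rangle-\psi(\theta))$ with respect to $\nu$, $\psi(\theta)=\log\int e^{\langle\theta,\phi\rangle}d\nu$, $\theta\in\Theta=\mathrm{int}\{\theta:\psi(\theta)<\infty\}$; write $\Lambda(\theta)=E_{p_\theta}[\phi]$, $Y=\Lambda(\Theta)$, and $\varphi(\eta)=\sup_{\theta\in\Theta}(\langle\theta,\eta\rangle-\psi(\theta))$. An *inference family* on $H$ consists of non-zero $\sigma$-finite base measures $\nu_i$ on measurable spaces $\mathcal X_i$ and measurable statistics $\phi_i:\mathcal X_i\to\mathbb R^{r_i}$ ($i\in V$) and $\phi_{\langle\alpha\rangle}:\mathcal X_\alpha=\prod_{i\in\alpha}\mathcal X_i\to\mathbb R^{r_\alpha}$ ($\alpha\in F$). Let $\mathcal E_i$ be the exponential family given by $(\nu_i,\phi_i)$ and $\mathcal E_\alpha$ the one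 given by $\nu_\alpha=\prod_{i\in\alpha}\nu_i$ and $\phi_\alpha=(\phi_{\langle\alpha\rangle},(\phi_i)_{i\in\alpha})$; the corresponding objects carry the index $i$ or $\alpha$. It is required that the Hessians of all $\psi_i$, $\psi_\alpha$ are invertible on $\Theta_i$, $\Theta_\alpha$, and that for $i\in\alpha$ the marginal on $\mathcal X_i$ of every member of $\mathcal E_\alpha$ belongs to $\mathcal E_i$. Let $L$ be the set of all $\eta=(\{\eta_{\langle\alpha\rangle}\}_{\alpha\in F},\{\eta_i\}_{i\in V})$ such that $\eta_i\in Y_i$ for all $i$ and $\eta_\alpha:=(\eta_{\langle\alpha\rangle},(\eta_i)_{i\in\alpha})\in Y_\alpha$ for all $\alpha$. For $\eta\in L$ let $b_i\in\mathcal E_i$ and $b_\alpha\in\mathcal E_\alpha$ be the members with expectation parameters $\eta_i$ and $\eta_\alpha$. For given vectors $\bar\theta_\alpha$ (compatibility functions $\Psi_\alpha=e^{\langle\bar\theta_\alpha,\phi_\alpha\rangle}$) the Bethe free energy is $$F(\eta)=-\sum_{\alpha\in F}\langle\bar\theta_\alpha,\eta_\alpha\rangle+\sum_{\alpha\in F}\varphi_\alpha(\eta_\alpha)+\sum_{i\in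 V}(1-d_i)\varphi_i(\eta_i).$$ **Zeta function.** Let $\vec E$ be the set of directed edges $e=(\alpha\to i)$, $i\in\alpha\in F$, with $s(e)=\alpha$, $t(e)=i$. Write $e'\rightharpoonup e$ if $t(e')\in s(e)$, $t(e')\ne t(e)$ and $s(e')\neq s(e)$. A closed geodesic is a sequence $(e_1,\dots,e_k)$, $k\ge1$, with $e_l\rightharpoonup e_{l+1}$ for all $l\in\mathbb Z/k\mathbb Z$; it is prime if it is not an $m$-fold repetition ($m\ge2$) of a closed geodesic; a prime cycle is a prime closed geodesic up to cyclic permutation. For complex matrix weights $u=\{u_{e'\rightharpoonup e}\}$, where $u_{e'\rightharpoonup e}$ is of size $r_{t(e)}\times r_{t(e')}$, put $$\zeta_H(u)=\prod_{\mathfrak p}\det(I-\pi(\mathfrak p))^{-1},\qquad \pi(\mathfrak p)=u_{e_k\rightharpoonup e_1}\cdots u_{e_2\rightharpoonup e_3}u_{e_1\rightharpoonup e_2}\ \text{ for } \mathfrak p=(e_1,\dots,e_k),$$ the product being over all prime cycles and taken for sufficiently small $u$. Let $M(u)$ be the operator $(M(u)f)(e)=\sum_{e':e'\rightharpoonup e}u_{e'\rightharpoonup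 e}f(e')$ on the functions $f$ on $\vec E$ with $f(e)\in\mathbb C^{r_{t(e)}}$. **Theorem (Bethe-zeta formula).** For all sufficiently small weights $u$ the Euler product $\zeta_H(u)$ converges, and $\zeta_H^{-1}$ extends uniquely to a holomorphic function, again denoted $\zeta_H^{-1}$, on the whole space of matrix weights. At every $\eta\in L$ the function $F$ is twice continuously differentiable, and with the weights $$u_{e'\rightharpoonup e}:=u^{s(e)}_{t(e')\to t(e)},\qquad u^\alpha_{i\to j}:=\mathrm{Var}_{b_j}(\phi_j)^{-1}\,\mathrm{Cov}_{b_\alpha}(\phi_j,\phi_i),$$ one has $$\zeta_H(u)^{-1}=\det(I-M(u))=\det(\nabla^2F(\eta))\prod_{\alpha\in F}\det\mathrm{Var}_{b_\alpha}(\phi_\alpha)\prod_{i\in V}\big(\det\mathrm{Var}_{b_i}(\phi_i)\big)^{1-d_i},$$ where $\nabla^2F$ is the Hessian in the coordinates $(\{\eta_{\langle\alpha\rangle}\},\{\eta_i\})$. -/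

import Mathlib

open MeasureTheory ProbabilityTheory Topology Matrix
open scoped ENNReal

noncomputable section

/-! ### Hessians -/

/-- The Hessian matrix `(∂²f / ∂x_a ∂x_b)(x)` of a function of the coordinates `x : κ → ℝ`. -/
def hessian {κ : Type*} [Fintype κ] [DecidableEq κ] (f : (κ → ℝ) → ℝ) (x : κ → ℝ) :
    Matrix κ κ ℝ :=
  Matrix.of fun a b => fderiv ℝ (fderiv ℝ f) x (Pi.single a 1) (Pi.single b 1)

/-! ### FinHypergraphs, directed edges, closed geodesics and prime cycles -/

/-- A (finite) hypergraph: a finite set of non-empty subsets of `V`. -/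
structure FinHypergraph (V : Type*) where
  edges : Finset (Finset V)
  nonempty_of_mem : ∀ α ∈ edges, α.Nonempty

namespace FinHypergraph

variable {V : Type*}

/-- The hyperedges (factors) of `H`, as a type. -/
abbrev Factor (H : FinHypergraph V) : Type _ := {α : Finset V // α ∈ H.edges}

/-- The degree `d_i`, the number of hyperedges that contain `i`. -/
def degree [DecidableEq V] (H : FinHypergraph V) (i : V) : ℕ :=
  (H.edges.filter fun α => i ∈ α).card

/-- The directed edges `α → i`, one for each pair `i ∈ α`. -/
abbrev DirEdge (H : FinHypergraph V) : Type _ := Σ α : H.Factor, {i : V // i ∈ α.1}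

/-- The starting hyperedge of a directed edge. -/
abbrev src {H : FinHypergraph V} (e : H.DirEdge) : H.Factor := e.1

/-- The terminus vertex of a directed edge. -/
abbrev tgt {H : FinHypergraph V} (e : H.DirEdge) : V := e.2.1

/-- The relation `e' ⇀ e`: the terminus of `e'` lies in the starting hyperedge of `e`, it is
not the terminus of `e`, and the two starting hyperedges are distinct (no backtracking). -/
def Follows (H : FinHypergraph V) (e' e : H.DirEdge) : Prop :=
  tgt e' ∈ (src e).1 ∧ tgt e' ≠ tgt e ∧ src e' ≠ src e

instance [DecidableEq V] (H : FinHypergraph V) : DecidableRel H.Follows := fun e' e =>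
  inferInstanceAs (Decidable (tgt e' ∈ (src e).1 ∧ tgt e' ≠ tgt e ∧ src e' ≠ src e))

/-- `(e_1, …, e_k)`, `k ≥ 1`, is a closed geodesic if `e_l ⇀ e_{l+1}` for all `l` modulo `k`. -/
def IsClosedGeodesic (H : FinHypergraph V) (c : List H.DirEdge) : Prop :=
  c ≠ [] ∧ Cycle.Chain H.Follows (c : Cycle H.DirEdge)

/-- A closed geodesic is prime if it is not the `m`-fold repetition, `m ≥ 2`, of a closed
geodesic. -/
def IsPrimeGeodesic (H : FinHypergraph V) (c : List H.DirEdge) : Prop :=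
  H.IsClosedGeodesic c ∧
    ∀ (c' : List H.DirEdge) (m : ℕ), 2 ≤ m → H.IsClosedGeodesic c' →
      c ≠ (List.replicate m c').flatten

/-- Prime cycles: prime closed geodesics up to cyclic permutation. -/
def PrimeCycle (H : FinHypergraph V) : Type _ :=
  {c : Cycle H.DirEdge // ∃ l : List H.DirEdge, (l : Cycle H.DirEdge) = c ∧ H.IsPrimeGeodesic l}

/-! ### The graph zeta function with matrix weights -/

/-- The pairs `(e', e)` with `e' ⇀ e`. -/
abbrev FollowsPair (H : FinHypergraph V) : Type _ :=
  {p : H.DirEdge × H.DirEdge // H.Follows p.1 p.2}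

/-- Matrix weights: a complex `r_e × r_{e'}` matrix (given by its entries) for each pair
`e' ⇀ e`. -/
abbrev Weight (H : FinHypergraph V) (r : H.DirEdge → ℕ) : Type _ :=
  (p : H.FollowsPair) → Fin (r p.1.2) → Fin (r p.1.1) → ℂ

variable [DecidableEq V] {H : FinHypergraph V} {r : H.DirEdge → ℕ}

/-- The block at `(e, e')`: the weight `u_{e' ⇀ e}` if `e' ⇀ e`, and `0` otherwise. -/
def Weight.block (u : H.Weight r) (e e' : H.DirEdge) : Matrix (Fin (r e)) (Fin (r e')) ℂ :=
  if h : H.Follows e' e then Matrix.of (u ⟨(e', e), h⟩) else 0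

/-- The matrix of the operator `(M(u) f)(e) = ∑_{e' ⇀ e} u_{e' ⇀ e} f(e')`. -/
def Weight.edgeMatrix (u : H.Weight r) :
    Matrix (Σ e : H.DirEdge, Fin (r e)) (Σ e : H.DirEdge, Fin (r e)) ℂ :=
  Matrix.of fun a b => u.block a.1 b.1 a.2 b.2

/-- `u_{e_k ⇀ b} ⋯ u_{e_1 ⇀ e_2} u_{a ⇀ e_1}` for the list `(e_1, …, e_k)`. -/
def Weight.pathProd (u : H.Weight r) :
    (a : H.DirEdge) → List H.DirEdge → (b : H.DirEdge) → Matrix (Fin (r b)) (Fin (r a)) ℂ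
  | a, [], b => u.block b a
  | a, c :: l, b => u.pathProd c l b * u.block c a

/-- `det (I - π)` with `π = u_{e_k ⇀ e_1} ⋯ u_{e_2 ⇀ e_3} u_{e_1 ⇀ e_2}`, for `(e_1, …, e_k)`. -/
def Weight.geodesicDet (u : H.Weight r) : List H.DirEdge → ℂ
  | [] => 1
  | e :: l => (1 - u.pathProd e l e).det

/-- `det (I - π(𝔭))` for a prime cycle `𝔭`. It is computed from a representative of the
cyclic equivalence class; it does not depend on the choice, as `det (I - AB) = det (I - BA)`. -/
def Weight.cycleDet (u : H.Weight r) (p : H.PrimeCycle) : ℂ :=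
  u.geodesicDet (Quotient.out p.1)

/-- The Euler product `∏_𝔭 det (I - π(𝔭))⁻¹`, which is the graph zeta function wherever the
product converges. -/
def Weight.eulerProduct (u : H.Weight r) : ℂ := ∏' p : H.PrimeCycle, (u.cycleDet p)⁻¹

/-- `Z` is the reciprocal `u ↦ ζ_H(u)⁻¹` of the graph zeta function on the whole space of matrix
weights: it is holomorphic on that space, and for all sufficiently small weights the Euler
product converges (unconditionally) and `Z` is its reciprocal. -/
def IsReciprocalZeta (H : FinHypergraph V) (r : H.DirEdge → ℕ)
    (Z : H.Weight r → ℂ) : Prop :=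
  AnalyticOnNhd ℂ Z Set.univ ∧
    ∀ᶠ u in 𝓝 (0 : H.Weight r),
      Multipliable (fun p : H.PrimeCycle => (u.cycleDet p)⁻¹) ∧ Z u = (u.eulerProduct)⁻¹

/-- The matrix weights `u_{e' ⇀ e} := u^{s(e)}_{t(e') → t(e)}` induced by a family of `r_j × r_i`
matrices `u^α_{i → j}`, `i, j ∈ α`; here `r_e := r_{t(e)}`. -/
def weightOfFactors (H : FinHypergraph V) (r : V → ℕ)
    (u : (α : H.Factor) → (i j : {i : V // i ∈ α.1}) → Matrix (Fin (r j)) (Fin (r i)) ℂ) :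
    H.Weight (fun e => r (tgt e)) :=
  fun p a b => u (src p.1.2) ⟨tgt p.1.1, p.2.1⟩ p.1.2.2 a b

end FinHypergraph

/-! ### Exponential families -/

/-- The data of an exponential family: a base measure and a vector of sufficient statistics. -/
structure ExpFamily (X : Type*) [MeasurableSpace X] (ι : Type*) where
  base : Measure X
  stat : X → ι → ℝ

namespace ExpFamily

variable {X : Type*} [MeasurableSpace X] {ι : Type*} [Fintype ι] (E : ExpFamily X ι)

/-- `∫ exp ⟨θ, φ(x)⟩ dν(x)`, possibly infinite. -/
def partition (θ : ι → ℝ) : ℝ≥0∞ :=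
  ∫⁻ x, ENNReal.ofReal (Real.exp (θ ⬝ᵥ E.stat x)) ∂E.base

/-- The log partition function `ψ`. -/
def logPartition (θ : ι → ℝ) : ℝ := Real.log (E.partition θ).toReal

/-- The set `Θ` of natural parameters. -/
def paramSet : Set (ι → ℝ) := interior {θ | E.partition θ < ⊤}

/-- The density `p(x; θ) = exp (⟨θ, φ(x)⟩ - ψ(θ))`. -/
def density (θ : ι → ℝ) (x : X) : ℝ := Real.exp (θ ⬝ᵥ E.stat x - E.logPartition θ)

/-- The distribution with density `p(·; θ)` with respect to the base measure. -/
def law (θ : ι → ℝ) : Measure X :=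
  E.base.withDensity fun x => ENNReal.ofReal (E.density θ x)

/-- The map `Λ` from natural parameters to expectation parameters, `θ ↦ E_{p_θ}[φ]`. -/
def meanMap (θ : ι → ℝ) : ι → ℝ := fun k => ∫ x, E.stat x k ∂E.law θ

/-- The set `Y = Λ(Θ)` of expectation parameters. -/
def meanSet : Set (ι → ℝ) := E.meanMap '' E.paramSet

/-- The Legendre transform `φ(η) = sup_{θ ∈ Θ} (⟨θ, η⟩ - ψ(θ))`. -/
def legendre (η : ι → ℝ) : ℝ := ⨆ θ : E.paramSet, (θ.1 ⬝ᵥ η - E.logPartition θ.1)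

/-- The member of the family with expectation parameter `η`, that is `p_{Λ⁻¹(η)}`. -/
def belief (η : ι → ℝ) : Measure X := E.law (Function.invFunOn E.meanMap E.paramSet η)

end ExpFamily

/-- The matrix `Cov_μ(f, g)` of covariances of the components of `f` and `g`. -/
def covMatrix {X : Type*} [MeasurableSpace X] {κ l : Type*} (μ : Measure X)
    (f : X → κ → ℝ) (g : X → l → ℝ) : Matrix κ l ℝ :=
  Matrix.of fun a b => cov[fun x => f x a, fun x => g x b; μ]

/-- The matrix `Var_μ(f) = Cov_μ(f, f)`. -/
def varMatrix {X : Type*} [MeasurableSpace X] {κ : Type*} (μ : Measure X)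
    (f : X → κ → ℝ) : Matrix κ κ ℝ := covMatrix μ f f

/-! ### Inference families -/

/-- The data of the exponential families on a hypergraph: base measures `ν_i` and sufficient
statistics `φ_i` at the vertices and additional sufficient statistics `φ_⟨α⟩` at the factors. -/
structure StatisticData {V : Type*} (H : FinHypergraph V) (X : V → Type*)
    [∀ i, MeasurableSpace (X i)] where
  dimV : V → ℕ
  base : (i : V) → Measure (X i)
  statV : (i : V) → X i → Fin (dimV i) → ℝ
  dimF : H.Factor → ℕ
  statF : (α : H.Factor) → ((i : {i : V // i ∈ α.1}) → X i) → Fin (dimF α) → ℝ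

namespace StatisticData

variable {V : Type*} {H : FinHypergraph V} {X : V → Type*} [∀ i, MeasurableSpace (X i)]
variable (S : StatisticData H X)

/-- The exponential family `E_i` on `X_i`. -/
def vertexFamily (i : V) : ExpFamily (X i) (Fin (S.dimV i)) where
  base := S.base i
  stat := S.statV i

/-- The components of `φ_α = (φ_⟨α⟩, (φ_i)_{i ∈ α})`. -/
abbrev FactorIdx (α : H.Factor) : Type _ :=
  Fin (S.dimF α) ⊕ (Σ i : {i : V // i ∈ α.1}, Fin (S.dimV i))

/-- The exponential family `E_α` on `X_α = ∏_{i ∈ α} X_i`, with base measure `∏_{i ∈ α} ν_i` and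
sufficient statistic `φ_α = (φ_⟨α⟩, (φ_i)_{i ∈ α})`. -/
def factorFamily (α : H.Factor) :
    ExpFamily ((i : {i : V // i ∈ α.1}) → X i) (S.FactorIdx α) where
  base := Measure.pi fun i => S.base i
  stat := fun x => Sum.elim (S.statF α x) fun k => S.statV k.1 (x k.1) k.2

end StatisticData

/-- An inference family: the Hessians of all the log partition functions are invertible on the
parameter sets, and the vertex marginals of the members of `E_α` belong to `E_i`, `i ∈ α`. -/
structure InferenceFamily {V : Type*} [DecidableEq V] (H : FinHypergraph V) (X : V → Type*)
    [∀ i, MeasurableSpace (X i)] extends StatisticData H X where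
  sigmaFinite_base : ∀ i, SigmaFinite (base i)
  base_ne_zero : ∀ i, base i ≠ 0
  measurable_statV : ∀ i, Measurable (statV i)
  measurable_statF : ∀ α, Measurable (statF α)
  hessian_vertex_invertible : ∀ i, ∀ θ ∈ (toStatisticData.vertexFamily i).paramSet,
    IsUnit (hessian (toStatisticData.vertexFamily i).logPartition θ)
  hessian_factor_invertible : ∀ α, ∀ θ ∈ (toStatisticData.factorFamily α).paramSet,
    IsUnit (hessian (toStatisticData.factorFamily α).logPartition θ)
  marginally_closed : ∀ (α : H.Factor) (i : {i : V // i ∈ α.1}),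
    ∀ θ ∈ (toStatisticData.factorFamily α).paramSet,
      ∃ θ' ∈ (toStatisticData.vertexFamily i).paramSet,
        ((toStatisticData.factorFamily α).law θ).map (fun x => x i) =
          (toStatisticData.vertexFamily i).law θ'

namespace InferenceFamily

variable {V : Type*} [DecidableEq V] {H : FinHypergraph V} {X : V → Type*}
  [∀ i, MeasurableSpace (X i)] (I : InferenceFamily H X)

/-- The index set of the coordinates `({η_⟨α⟩}_α, {η_i}_i)`. -/
abbrev Coord : Type _ := (Σ α : H.Factor, Fin (I.dimF α)) ⊕ (Σ i : V, Fin (I.dimV i))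

/-- The component `η_i`. -/
def vertexPart (η : I.Coord → ℝ) (i : V) : Fin (I.dimV i) → ℝ := fun k => η (.inr ⟨i, k⟩)

/-- The component `η_α = (η_⟨α⟩, (η_i)_{i ∈ α})`, by local consistency `η_{α:i} = η_i`. -/
def factorPart (η : I.Coord → ℝ) (α : H.Factor) : I.FactorIdx α → ℝ :=
  Sum.elim (fun k => η (.inl ⟨α, k⟩)) fun k => η (.inr ⟨k.1, k.2⟩)

/-- The local-consistency set `L`, in the coordinates `({η_⟨α⟩}_α, {η_i}_i)`. -/
def localSet : Set (I.Coord → ℝ) :=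
  {η | (∀ α, I.factorPart η α ∈ (I.factorFamily α).meanSet) ∧
    ∀ i, I.vertexPart η i ∈ (I.vertexFamily i).meanSet}

/-- The Bethe free energy for the compatibility functions `Ψ_α = exp ⟨θbar_α, φ_α⟩`. -/
def betheFreeEnergy [Fintype V] (θbar : (α : H.Factor) → I.FactorIdx α → ℝ)
    (η : I.Coord → ℝ) : ℝ :=
  -(∑ α : H.Factor, θbar α ⬝ᵥ I.factorPart η α)
    + ∑ α : H.Factor, (I.factorFamily α).legendre (I.factorPart η α)
    + ∑ i : V, (1 - (H.degree i : ℝ)) * (I.vertexFamily i).legendre (I.vertexPart η i)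

/-- The belief `b_i` specified by `η`. -/
def vertexBelief (η : I.Coord → ℝ) (i : V) : Measure (X i) :=
  (I.vertexFamily i).belief (I.vertexPart η i)

/-- The belief `b_α` specified by `η`. -/
def factorBelief (η : I.Coord → ℝ) (α : H.Factor) :
    Measure ((i : {i : V // i ∈ α.1}) → X i) :=
  (I.factorFamily α).belief (I.factorPart η α)

/-- `Var_{b_i}(φ_i)`. -/
def vertexVar (η : I.Coord → ℝ) (i : V) : Matrix (Fin (I.dimV i)) (Fin (I.dimV i)) ℝ :=
  varMatrix (I.vertexBelief η i) (I.statV i)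

/-- `Var_{b_α}(φ_α)`. -/
def factorVar (η : I.Coord → ℝ) (α : H.Factor) : Matrix (I.FactorIdx α) (I.FactorIdx α) ℝ :=
  varMatrix (I.factorBelief η α) (I.factorFamily α).stat

/-- `u^α_{i → j} = Var_{b_j}(φ_j)⁻¹ Cov_{b_α}(φ_j, φ_i)`. -/
def factorWeight (η : I.Coord → ℝ) (α : H.Factor) (i j : {i : V // i ∈ α.1}) :
    Matrix (Fin (I.dimV j)) (Fin (I.dimV i)) ℝ :=
  (I.vertexVar η j)⁻¹ *
    covMatrix (I.factorBelief η α) (fun x => I.statV j (x j)) (fun x => I.statV i (x i))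

/-- The size `r_e := r_{t(e)}` of the matrix weights. -/
abbrev edgeDim (e : H.DirEdge) : ℕ := I.dimV (FinHypergraph.tgt e)

/-- The matrix weights `u_{e' ⇀ e} = u^{s(e)}_{t(e') → t(e)}` at `η`. -/
def weight (η : I.Coord → ℝ) : H.Weight I.edgeDim :=
  H.weightOfFactors I.dimV fun α i j => (I.factorWeight η α i j).map Complex.ofReal

end InferenceFamily

end

/-!
Counting cyclic words by their primitive roots turns the logarithm of the Euler product into
`∑ₙ tr (M(u)ⁿ) / n`, so `ζ_H(u)⁻¹ = det (1 - M(u))` for small `u`; the right side is a polynomial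
in `u`, and the identity theorem makes it the only holomorphic extension.

By the inverse function theorem the Hessian of the Legendre transform of `ψ` is the inverse of
`∇²ψ`, the variance of the sufficient statistic. With `N` the incidence matrix of directed edges
and vertices, extended by the identity on the coordinates `η_⟨α⟩`, this gives
`∇²F = Nᵀ A⁻¹ N + S`, `A` and `S` being block diagonal with blocks `Var_{b_α}(φ_α)` and
`(1 - d_i) Var_{b_i}(φ_i)⁻¹`. On the edge components `M(u) = T (N Nᵀ - 1)`, where `1 + T` is the
corresponding block of `A` normalised by the vertex variances, and `Nᵀ N` is the diagonal matrix
of the degrees. The formula `det (1 + XY) = det (1 + YX)` then identifies the two determinants up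
to those of the variances.
-/

/-! ### Powers and rotations of words -/

section Words

variable {α : Type*}

/-- The `m`-th power of a word in the free monoid, for the words written as lists. -/
def wordPow (x : List α) (m : ℕ) : List α := (List.replicate m x).flatten

/-- The least positive number of one-step rotations that fix a word: the length of its primitive
root. The empty word has period `1`. -/
noncomputable def rotationPeriod (x : List α) : ℕ :=
  Function.minimalPeriod (fun l : List α => l.rotate 1) x

theorem wordPow_succ (x : List α) (m : ℕ) : wordPow x (m + 1) = x ++ wordPow x m := rfl

@[simp]
theorem wordPow_one (x : List α) : wordPow x 1 = x := List.append_nil x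

@[simp]
theorem length_wordPow (x : List α) (m : ℕ) : (wordPow x m).length = m * x.length := by
  simp [wordPow]

theorem wordPow_append_succ (x y : List α) (m : ℕ) :
    wordPow (x ++ y) (m + 1) = x ++ wordPow (y ++ x) m ++ y := by
  induction m with
  | zero => simp [wordPow]
  | succ m ih => rw [wordPow_succ, ih, wordPow_succ (y ++ x)]; simp only [List.append_assoc]

theorem wordPow_succ' (x : List α) (m : ℕ) : wordPow x (m + 1) = wordPow x m ++ x := by
  simpa using wordPow_append_succ [] x m

theorem wordPow_succ_injective (m : ℕ) :
    Function.Injective fun x : List α => wordPow x (m + 1) := by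
  intro x y h
  have hlen : (m + 1) * x.length = (m + 1) * y.length := by
    simpa only [length_wordPow] using congrArg List.length h
  exact (List.append_inj h (Nat.eq_of_mul_eq_mul_left m.succ_pos hlen)).1

theorem iterate_rotate_one (n : ℕ) (x : List α) :
    (fun l : List α => l.rotate 1)^[n] x = x.rotate n := by
  induction n with
  | zero => simp
  | succ n ih => rw [Function.iterate_succ_apply', ih, List.rotate_rotate]

theorem rotate_one_wordPow (x : List α) (m : ℕ) :
    (wordPow x m).rotate 1 = wordPow (x.rotate 1) m := by
  cases m with
  | zero => simp [wordPow]
  | succ m =>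
    cases x with
    | nil => simp [wordPow]
    | cons a l =>
      have h := wordPow_append_succ [a] l m
      rw [List.singleton_append, List.append_assoc, List.singleton_append] at h
      rw [h, List.rotate_cons_succ, List.rotate_zero, List.rotate_cons_succ, List.rotate_zero,
        wordPow_succ', List.append_assoc]

theorem rotate_wordPow (x : List α) (m n : ℕ) :
    (wordPow x m).rotate n = wordPow (x.rotate n) m := by
  induction n with
  | zero => simp
  | succ n ih => rw [← List.rotate_rotate, ih, rotate_one_wordPow, List.rotate_rotate]

theorem rotate_eq_self_iff_rotationPeriod_dvd {x : List α} {n : ℕ} :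
    x.rotate n = x ↔ rotationPeriod x ∣ n := by
  rw [rotationPeriod, ← Function.isPeriodicPt_iff_minimalPeriod_dvd, Function.IsPeriodicPt,
    Function.IsFixedPt, iterate_rotate_one]

theorem rotationPeriod_dvd_length (x : List α) : rotationPeriod x ∣ x.length :=
  rotate_eq_self_iff_rotationPeriod_dvd.1 x.rotate_length

theorem rotationPeriod_wordPow_succ (x : List α) (m : ℕ) :
    rotationPeriod (wordPow x (m + 1)) = rotationPeriod x := by
  refine Nat.dvd_right_iff_eq.1 fun n => ?_
  rw [← rotate_eq_self_iff_rotationPeriod_dvd, ← rotate_eq_self_iff_rotationPeriod_dvd,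
    rotate_wordPow]
  exact (wordPow_succ_injective m).eq_iff

theorem rotationPeriod_rotate (x : List α) (k : ℕ) :
    rotationPeriod (x.rotate k) = rotationPeriod x := by
  refine Nat.dvd_right_iff_eq.1 fun n => ?_
  rw [← rotate_eq_self_iff_rotationPeriod_dvd, ← rotate_eq_self_iff_rotationPeriod_dvd,
    List.rotate_rotate, add_comm, ← List.rotate_rotate]
  exact (List.rotate_injective k).eq_iff

theorem eq_wordPow_of_append_comm {x y : List α} {m : ℕ} (hcomm : x ++ y = y ++ x)
    (hlen : y.length = m * x.length) : y = wordPow x m := by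
  induction m generalizing y with
  | zero => simpa [wordPow] using hlen
  | succ m ih =>
    have hle : x.length ≤ y.length := hlen ▸ Nat.le_mul_of_pos_left _ m.succ_pos
    have hprefix : x <+: y :=
      List.prefix_of_prefix_length_le (hcomm ▸ List.prefix_append x y) (List.prefix_append y x) hle
    obtain ⟨z, rfl⟩ := hprefix
    rw [wordPow_succ, ← ih (y := z)]
    · simpa using hcomm
    · rw [List.length_append, Nat.succ_mul] at hlen
      omega

theorem exists_eq_wordPow_succ_rotationPeriod {x : List α} (hx : x ≠ []) :
    ∃ (y : List α) (m : ℕ), x = wordPow y (m + 1) ∧ y.length = rotationPeriod x := by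
  obtain ⟨n, hn⟩ := rotationPeriod_dvd_length x
  have hlen := List.length_pos_of_ne_nil hx
  obtain ⟨m, rfl⟩ := Nat.exists_eq_succ_of_ne_zero (Nat.pos_of_mul_pos_left (hn ▸ hlen)).ne'
  have hle : rotationPeriod x ≤ x.length := Nat.le_of_dvd hlen (rotationPeriod_dvd_length x)
  have htake : (x.take (rotationPeriod x)).length = rotationPeriod x := by
    rw [List.length_take, min_eq_left hle]
  have hrot : x.drop (rotationPeriod x) ++ x.take (rotationPeriod x) = x := by
    rw [← List.rotate_eq_drop_append_take hle, rotate_eq_self_iff_rotationPeriod_dvd]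
  refine ⟨x.take (rotationPeriod x), m, eq_wordPow_of_append_comm ?_ ?_, htake⟩
  · calc x.take (rotationPeriod x) ++ x
        = x.take (rotationPeriod x) ++
            (x.drop (rotationPeriod x) ++ x.take (rotationPeriod x)) := by rw [hrot]
      _ = x ++ x.take (rotationPeriod x) := by rw [← List.append_assoc, List.take_append_drop]
  · rw [htake, hn, mul_comm]

end Words

/-! ### Closed geodesics as powers of prime geodesics -/

namespace FinHypergraph

variable {V : Type*} {H : FinHypergraph V}

theorem IsClosedGeodesic.length_pos {x : List H.DirEdge} (h : H.IsClosedGeodesic x) :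
    0 < x.length := List.length_pos_of_ne_nil h.1

theorem IsClosedGeodesic.of_wordPow {x : List H.DirEdge} {m : ℕ}
    (h : H.IsClosedGeodesic (wordPow x m)) : H.IsClosedGeodesic x := by
  obtain ⟨hne, hchain⟩ := h
  rcases x with _ | ⟨a, l⟩
  · simp [wordPow] at hne
  refine ⟨by simp, ?_⟩
  rcases m with _ | m
  · simp [wordPow] at hne
  rw [wordPow_succ, List.cons_append, Cycle.chain_coe_cons] at hchain
  rw [Cycle.chain_coe_cons]
  cases m with
  | zero => simpa [wordPow] using hchain
  | succ m =>
    exact .left_of_append (l₂ := l ++ wordPow (a :: l) m ++ [a])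
      (by simpa [wordPow_succ] using hchain)

theorem isClosedGeodesic_rotate {x : List H.DirEdge} (n : ℕ) :
    H.IsClosedGeodesic (x.rotate n) ↔ H.IsClosedGeodesic x := by
  have hcycle : ((x.rotate n : List H.DirEdge) : Cycle H.DirEdge) = x :=
    Cycle.coe_eq_coe.2 (List.IsRotated.forall x n)
  simp [IsClosedGeodesic, hcycle]

theorem isPrimeGeodesic_iff_rotationPeriod_eq_length {x : List H.DirEdge} :
    H.IsPrimeGeodesic x ↔ H.IsClosedGeodesic x ∧ rotationPeriod x = x.length := by
  refine and_congr_right fun hx => ⟨fun h => ?_, fun h y m hm hy hxy => ?_⟩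
  · obtain ⟨y, m, hxy, hy⟩ := exists_eq_wordPow_succ_rotationPeriod hx.1
    rcases m with _ | m
    · rw [← hy, hxy, wordPow_one]
    · exact absurd hxy (h y (m + 2) (by omega) (.of_wordPow (hxy ▸ hx)))
  · obtain ⟨k, rfl⟩ := Nat.exists_eq_add_of_le' (one_le_two.trans hm)
    have hper : rotationPeriod x = rotationPeriod y := hxy ▸ rotationPeriod_wordPow_succ y k
    have hle := Nat.le_of_dvd hy.length_pos (rotationPeriod_dvd_length y)
    have hlen : x.length = (k + 1) * y.length := hxy ▸ length_wordPow y (k + 1)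
    have := hy.length_pos
    nlinarith

theorem IsPrimeGeodesic.rotate {x : List H.DirEdge} (h : H.IsPrimeGeodesic x) (n : ℕ) :
    H.IsPrimeGeodesic (x.rotate n) := by
  rw [isPrimeGeodesic_iff_rotationPeriod_eq_length] at h ⊢
  rwa [isClosedGeodesic_rotate, rotationPeriod_rotate, List.length_rotate]

theorem IsPrimeGeodesic.rotate_inj {x : List H.DirEdge} (h : H.IsPrimeGeodesic x)
    {i j : Fin x.length} (hij : x.rotate i = x.rotate j) : i = j := by
  have hlen := (isPrimeGeodesic_iff_rotationPeriod_eq_length.1 h).2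
  refine Fin.ext (Function.iterate_injOn_Iio_minimalPeriod
    (f := fun l : List H.DirEdge => l.rotate 1) (x := x)
    (i.2.trans_eq hlen.symm) (j.2.trans_eq hlen.symm) ?_)
  simpa only [iterate_rotate_one] using hij

theorem IsPrimeGeodesic.eq_of_wordPow_succ_eq {x y : List H.DirEdge} (hx : H.IsPrimeGeodesic x)
    (hy : H.IsPrimeGeodesic y) {m n : ℕ} (h : wordPow x (m + 1) = wordPow y (n + 1)) :
    x = y ∧ m = n := by
  have hxy : x.length = y.length := by
    rw [← (isPrimeGeodesic_iff_rotationPeriod_eq_length.1 hx).2,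
      ← (isPrimeGeodesic_iff_rotationPeriod_eq_length.1 hy).2,
      ← rotationPeriod_wordPow_succ x m, h, rotationPeriod_wordPow_succ]
  have hmn : (m + 1) * x.length = (n + 1) * x.length := by
    simpa only [length_wordPow, ← hxy] using congrArg List.length h
  exact ⟨(List.append_inj h hxy).1,
    Nat.succ_injective (Nat.eq_of_mul_eq_mul_right hx.1.length_pos hmn)⟩

theorem IsClosedGeodesic.exists_eq_wordPow_succ {c : List H.DirEdge} (h : H.IsClosedGeodesic c) :
    ∃ (x : List H.DirEdge) (m : ℕ), H.IsPrimeGeodesic x ∧ c = wordPow x (m + 1) := by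
  obtain ⟨x, m, rfl, hlen⟩ := exists_eq_wordPow_succ_rotationPeriod h.1
  rw [rotationPeriod_wordPow_succ] at hlen
  exact ⟨x, m, isPrimeGeodesic_iff_rotationPeriod_eq_length.2 ⟨h.of_wordPow, hlen.symm⟩, rfl⟩

/-- A prime geodesic that represents the given prime cycle: the one from which
`Weight.cycleDet` is computed. -/
noncomputable def PrimeCycle.rep (p : H.PrimeCycle) : List H.DirEdge := Quotient.out p.1

theorem PrimeCycle.coe_rep (p : H.PrimeCycle) : (p.rep : Cycle H.DirEdge) = p.1 :=
  Quotient.out_eq p.1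

theorem PrimeCycle.isPrimeGeodesic_rep (p : H.PrimeCycle) : H.IsPrimeGeodesic p.rep := by
  obtain ⟨x, hx, hprime⟩ := p.2
  obtain ⟨n, hn⟩ := Cycle.coe_eq_coe.1 (hx.trans p.coe_rep.symm)
  exact hn ▸ hprime.rotate n

/-- The parametrization of the closed geodesics by a prime cycle `p`, an exponent and a starting
point on `p`. The exponent is shifted by one, so that `m` stands for the `(m + 1)`-st power. -/
noncomputable def PrimeCycle.toGeodesic (t : Σ p : H.PrimeCycle, ℕ × Fin p.rep.length) :
    List H.DirEdge :=
  wordPow (t.1.rep.rotate t.2.2) (t.2.1 + 1)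

theorem PrimeCycle.toGeodesic_injective :
    Function.Injective (PrimeCycle.toGeodesic (H := H)) := by
  rintro ⟨p, m, i⟩ ⟨q, n, j⟩ h
  obtain ⟨hrot, rfl⟩ := (p.isPrimeGeodesic_rep.rotate i).eq_of_wordPow_succ_eq
    (q.isPrimeGeodesic_rep.rotate j) h
  have hpq : p.rep ~r q.rep :=
    (List.IsRotated.forall p.rep i).symm.trans (hrot ▸ List.IsRotated.forall q.rep j)
  obtain rfl : p = q := Subtype.ext (by rw [← p.coe_rep, ← q.coe_rep, Cycle.coe_eq_coe.2 hpq])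
  rw [p.isPrimeGeodesic_rep.rotate_inj hrot]

theorem IsClosedGeodesic.mem_range_toGeodesic {c : List H.DirEdge} (h : H.IsClosedGeodesic c) :
    c ∈ Set.range (PrimeCycle.toGeodesic (H := H)) := by
  obtain ⟨x, m, hx, rfl⟩ := h.exists_eq_wordPow_succ
  let p : H.PrimeCycle := ⟨x, x, rfl, hx⟩
  obtain ⟨n, hn⟩ := Cycle.coe_eq_coe.1 p.coe_rep
  refine ⟨⟨p, m, n % p.rep.length, Nat.mod_lt _ p.isPrimeGeodesic_rep.1.length_pos⟩, ?_⟩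
  simp only [PrimeCycle.toGeodesic, List.rotate_mod]
  rw [hn]

end FinHypergraph

/-! ### The logarithm of a determinant -/

section TraceLog

open Polynomial

variable {n : Type*} [Fintype n] [DecidableEq n]

section Field

variable {K : Type*} [Field K] [IsAlgClosed K] (A : Matrix n n K)

theorem card_roots_charpoly : A.charpoly.roots.card = Fintype.card n := by
  rw [← (IsAlgClosed.splits A.charpoly).natDegree_eq_card_roots, A.charpoly_natDegree_eq_dim]

theorem det_aeval_X_add_C_eq_prod_roots (a : K) :
    (aeval A (X + C a)).det = (A.charpoly.roots.map fun x => x + a).prod := by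
  have hneg : aeval A (X + C a) = -(scalar n (-a) - A) := by
    rw [map_add, aeval_X, aeval_C, neg_sub, map_neg, sub_neg_eq_add]
    rfl
  have hsum : ∀ x, x + a = -1 * (-a - x) := fun x => by ring
  rw [hneg, det_neg, ← eval_charpoly,
    (IsAlgClosed.splits A.charpoly).eval_eq_prod_roots_of_monic A.charpoly_monic,
    ← card_roots_charpoly A]
  simp only [hsum, Multiset.prod_map_mul, Multiset.map_const', Multiset.prod_replicate]

theorem det_aeval_eq_prod_roots (p : K[X]) :
    (aeval A p).det = (A.charpoly.roots.map fun x => p.eval x).prod := by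
  induction IsAlgClosed.splits p using Submonoid.closure_induction with
  | mem q hq =>
    rcases hq with ⟨a, rfl⟩ | ⟨a, rfl⟩
    · simp [algebraMap_eq_diagonal, card_roots_charpoly]
    · simpa using det_aeval_X_add_C_eq_prod_roots A a
  | one => simp
  | mul p q _ _ hp hq => simp only [map_mul, det_mul, hp, hq, eval_mul, Multiset.prod_map_mul]

theorem det_one_sub_eq_prod_roots : (1 - A).det = (A.charpoly.roots.map fun x => 1 - x).prod := by
  have h := det_aeval_eq_prod_roots A (1 - X)
  simpa only [map_sub, map_one, aeval_X, eval_sub, eval_one, eval_X] using h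

theorem roots_charpoly_aeval (p : K[X]) :
    (aeval A p).charpoly.roots = A.charpoly.roots.map fun x => p.eval x := by
  suffices h : (aeval A p).charpoly =
      ((A.charpoly.roots.map fun x => p.eval x).map fun y => X - C y).prod by
    rw [h, roots_multiset_prod_X_sub_C]
  refine Polynomial.funext fun x => ?_
  calc (aeval A p).charpoly.eval x
      = (aeval A (C x - p)).det := by rw [eval_charpoly, map_sub, aeval_C]; rfl
    _ = (A.charpoly.roots.map fun y => (C x - p).eval y).prod := det_aeval_eq_prod_roots A _
    _ = _ := by simp [eval_multiset_prod]

theorem trace_pow_eq_sum_roots (k : ℕ) :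
    (A ^ k).trace = (A.charpoly.roots.map fun x => x ^ k).sum := by
  have h := roots_charpoly_aeval A (X ^ k)
  simp only [map_pow, aeval_X, eval_pow, eval_X] at h
  rw [trace_eq_sum_roots_charpoly, h]

end Field

/-- The series `∑_{k ≥ 1} tr (A ^ k) / k` for `-log det (1 - A)`. -/
noncomputable def traceLog (A : Matrix n n ℂ) : ℂ := ∑' k : ℕ, (A ^ (k + 1)).trace / (k + 1)

variable {A : Matrix n n ℂ}

theorem hasSum_trace_pow_div (hA : ∀ x ∈ A.charpoly.roots, ‖x‖ < 1) :
    HasSum (fun k : ℕ => (A ^ (k + 1)).trace / (k + 1))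
      (A.charpoly.roots.map fun x => -Complex.log (1 - x)).sum := by
  simp only [trace_pow_eq_sum_roots]
  generalize A.charpoly.roots = s at hA
  induction s using Multiset.induction with
  | empty => simp
  | cons x s ih =>
    simp only [Multiset.map_cons, Multiset.sum_cons, add_div]
    exact (Complex.hasSum_taylorSeries_neg_log' (hA x (s.mem_cons_self x))).add
      (ih fun y hy => hA y (Multiset.mem_cons_of_mem hy))

theorem exp_traceLog (hA : ∀ x ∈ A.charpoly.roots, ‖x‖ < 1) :
    Complex.exp (traceLog A) = ((1 - A).det)⁻¹ := by
  have hexp : ∀ x ∈ A.charpoly.roots, Complex.exp (-Complex.log (1 - x)) = (1 - x)⁻¹ := by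
    intro x hx
    have hne : 1 - x ≠ 0 := sub_ne_zero.2 fun h => by simpa [← h] using hA x hx
    rw [Complex.exp_neg, Complex.exp_log hne]
  rw [traceLog, (hasSum_trace_pow_div hA).tsum_eq, Complex.exp_multiset_sum, Multiset.map_map,
    det_one_sub_eq_prod_roots, ← Multiset.prod_map_inv]
  exact congrArg Multiset.prod (Multiset.map_congr rfl hexp)

open scoped Matrix.Norms.Operator in
theorem norm_lt_one_of_mem_roots_charpoly (hA : ‖A‖ < 1) : ∀ x ∈ A.charpoly.roots, ‖x‖ < 1 := by
  intro x hx
  rcases isEmpty_or_nonempty n with _ | _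
  · simp [charpoly] at hx
  · exact (spectrum.norm_le_norm_of_mem
      (mem_spectrum_of_isRoot_charpoly (isRoot_of_mem_roots hx))).trans_lt hA

open scoped Matrix.Norms.Operator in
theorem norm_trace_le_card_mul_norm (A : Matrix n n ℂ) : ‖A.trace‖ ≤ Fintype.card n * ‖A‖ := by
  have hentry : ∀ i, ‖A i i‖₊ ≤ ‖A‖₊ := fun i => by
    rw [linfty_opNNNorm_def]
    exact (Finset.single_le_sum (f := fun j => ‖A i j‖₊) (fun _ _ => zero_le)
      (Finset.mem_univ i)).trans
      (Finset.le_sup (f := fun i => ∑ j, ‖A i j‖₊) (Finset.mem_univ i))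
  calc ‖A.trace‖ ≤ ∑ i, ‖A i i‖ := norm_sum_le _ _
    _ ≤ ∑ _i : n, ‖A‖ := Finset.sum_le_sum fun i _ => hentry i
    _ = Fintype.card n * ‖A‖ := by simp

end TraceLog

/-! ### Summation over words -/

section Words

variable {E : Type*} [Fintype E]

theorem sum_fun_fin_succ {M : Type*} [AddCommMonoid M] {k : ℕ} (f : (Fin (k + 1) → E) → M) :
    ∑ v, f v = ∑ e : E, ∑ w : Fin k → E, f (Fin.cons e w) := by
  rw [← (Fin.consEquiv fun _ => E).sum_comp, Fintype.sum_prod_type]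
  rfl

theorem hasSum_sum_ofFn {M : Type*} [AddCommMonoid M] [TopologicalSpace M] [ContinuousAdd M]
    [RegularSpace M] {f : List E → M} {s : M} (hf : HasSum f s) :
    HasSum (fun k : ℕ => ∑ v : Fin k → E, f (List.ofFn v)) s :=
  (List.equivSigmaTuple.symm.hasSum_iff.2 hf).sigma fun _ => hasSum_fintype _

theorem summable_pow_length {δ : ℝ} (hδ : 0 ≤ δ) (h : Fintype.card E * δ < 1) :
    Summable fun l : List E => δ ^ l.length := by
  rw [← List.equivSigmaTuple.symm.summable_iff]
  refine (summable_sigma_of_nonneg fun _ => pow_nonneg hδ _).2 ⟨fun _ => .of_finite, ?_⟩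
  refine (summable_geometric_of_lt_one (by positivity) h).congr fun k => ?_
  simp [List.equivSigmaTuple, mul_pow]

end Words

/-! ### The Euler product as a determinant -/

namespace FinHypergraph

variable {V : Type*} [DecidableEq V] {H : FinHypergraph V} {r : H.DirEdge → ℕ}

namespace Weight

variable (u : H.Weight r)

theorem follows_of_block_ne_zero {u : H.Weight r} {e e' : H.DirEdge} (h : u.block e e' ≠ 0) :
    H.Follows e' e :=
  not_not.1 fun hf => h (dif_neg hf)

open scoped ContDiff in
theorem contDiff_block_apply {m : ℕ∞ω} (e e' : H.DirEdge) (k : Fin (r e)) (l : Fin (r e')) :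
    ContDiff ℂ m fun u : H.Weight r => u.block e e' k l := by
  by_cases h : H.Follows e' e
  · simp only [block, h, dite_true, Matrix.of_apply]
    let p : H.FollowsPair := ⟨(e', e), h⟩
    exact contDiff_pi.1 (contDiff_pi.1 (contDiff_pi.1 contDiff_id p) k) l
  · simp only [block, h, dite_false, Matrix.zero_apply]
    exact contDiff_const

theorem block_zero (e e' : H.DirEdge) : (0 : H.Weight r).block e e' = 0 :=
  dite_eq_right_iff.2 fun _ => rfl

theorem edgeMatrix_zero : (0 : H.Weight r).edgeMatrix = 0 :=
  Matrix.ext fun a b => congrFun₂ (block_zero a.1 b.1) a.2 b.2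

theorem pathProd_append (a c b : H.DirEdge) (l l' : List H.DirEdge) :
    u.pathProd a (l ++ c :: l') b = u.pathProd c l' b * u.pathProd a l c := by
  induction l generalizing a with
  | nil => rfl
  | cons d l ih => simp only [List.cons_append, pathProd, ih, Matrix.mul_assoc]

theorem pathProd_wordPow (e : H.DirEdge) (l : List H.DirEdge) (m : ℕ) :
    u.pathProd e (l ++ wordPow (e :: l) m) e = u.pathProd e l e ^ (m + 1) := by
  induction m with
  | zero => simp [wordPow]
  | succ m ih => rw [wordPow_succ, List.cons_append, pathProd_append, ih, pow_succ _ (m + 1)]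

theorem isChain_follows_of_pathProd_ne_zero {u : H.Weight r} {a b : H.DirEdge}
    {l : List H.DirEdge} (h : u.pathProd a l b ≠ 0) :
    List.IsChain H.Follows (a :: (l ++ [b])) := by
  induction l generalizing a with
  | nil => simpa using follows_of_block_ne_zero h
  | cons c l ih =>
    have hfirst : u.block c a ≠ 0 := fun h0 => h (by rw [pathProd, h0, Matrix.mul_zero])
    have hrest : u.pathProd c l b ≠ 0 := fun h0 => h (by rw [pathProd, h0, Matrix.zero_mul])
    simpa using ⟨follows_of_block_ne_zero hfirst, ih hrest⟩

/-- The trace of the product of the weights along a word read cyclically; it vanishes unless the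
word is a closed geodesic. -/
noncomputable def wordTrace : List H.DirEdge → ℂ
  | [] => 0
  | e :: l => (u.pathProd e l e).trace

theorem wordTrace_rotate (c : List H.DirEdge) (n : ℕ) :
    u.wordTrace (c.rotate n) = u.wordTrace c := by
  have hone : ∀ c, u.wordTrace (c.rotate 1) = u.wordTrace c := by
    rintro (_ | ⟨e, _ | ⟨f, l⟩⟩)
    · rfl
    · rw [List.rotate_singleton]
    · rw [List.rotate_cons_succ, List.rotate_zero, List.cons_append, wordTrace, pathProd_append,
        Matrix.trace_mul_comm]
      rfl
  induction n with
  | zero => rw [List.rotate_zero]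
  | succ n ih => rw [← List.rotate_rotate, hone, ih]

theorem wordTrace_wordPow_succ (e : H.DirEdge) (l : List H.DirEdge) (m : ℕ) :
    u.wordTrace (wordPow (e :: l) (m + 1)) = (u.pathProd e l e ^ (m + 1)).trace := by
  rw [wordPow_succ, List.cons_append, ← pathProd_wordPow, wordTrace]

theorem isClosedGeodesic_of_wordTrace_ne_zero {u : H.Weight r} {c : List H.DirEdge}
    (h : u.wordTrace c ≠ 0) : H.IsClosedGeodesic c := by
  rcases c with _ | ⟨e, l⟩
  · exact absurd rfl h
  refine ⟨List.cons_ne_nil e l, ?_⟩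
  rw [Cycle.chain_coe_cons]
  refine isChain_follows_of_pathProd_ne_zero (u := u) fun h0 => h ?_
  rw [wordTrace, h0, Matrix.trace_zero]

theorem sum_pathProd_eq_edgeMatrix_pow (k : ℕ) (a b : H.DirEdge) :
    ∑ v : Fin k → H.DirEdge, u.pathProd a (List.ofFn v) b =
      Matrix.of fun i j => (u.edgeMatrix ^ (k + 1)) ⟨b, i⟩ ⟨a, j⟩ := by
  induction k generalizing a with
  | zero => simp [pathProd]; rfl
  | succ k ih =>
    rw [sum_fun_fin_succ]
    simp only [List.ofFn_cons, pathProd, ← Matrix.sum_mul, ih]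
    ext i j
    rw [Matrix.sum_apply, Matrix.of_apply]
    conv_rhs => rw [pow_succ, Matrix.mul_apply, Fintype.sum_sigma]
    rfl

theorem sum_wordTrace_eq_trace_pow (k : ℕ) :
    ∑ v : Fin (k + 1) → H.DirEdge, u.wordTrace (List.ofFn v) = (u.edgeMatrix ^ (k + 1)).trace := by
  rw [sum_fun_fin_succ]
  simp_rw [List.ofFn_cons, wordTrace, ← Matrix.trace_sum, sum_pathProd_eq_edgeMatrix_pow]
  conv_rhs => rw [Matrix.trace, Fintype.sum_sigma]
  rfl

section Norm

open scoped Matrix.Norms.Operator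

variable {u} {δ : ℝ}

theorem norm_pathProd_le (hδ : ∀ e e', ‖u.block e e'‖ ≤ δ) (a b : H.DirEdge)
    (l : List H.DirEdge) : ‖u.pathProd a l b‖ ≤ δ ^ (l.length + 1) := by
  have hnonneg : 0 ≤ δ := (norm_nonneg _).trans (hδ a a)
  induction l generalizing a with
  | nil => simpa [pathProd] using hδ b a
  | cons c l ih =>
    rw [pathProd, List.length_cons, pow_succ]
    exact (Matrix.linfty_opNorm_mul _ _).trans
      (mul_le_mul (ih c) (hδ c a) (norm_nonneg _) (pow_nonneg hnonneg _))

theorem norm_wordTrace_le (hδ : ∀ e e', ‖u.block e e'‖ ≤ δ) (c : List H.DirEdge) :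
    ‖u.wordTrace c‖ ≤ (∑ e, r e : ℕ) * δ ^ c.length := by
  rcases c with _ | ⟨e, l⟩
  · simpa [wordTrace] using Finset.sum_nonneg fun _ _ => Nat.cast_nonneg _
  calc ‖u.wordTrace (e :: l)‖ ≤ r e * ‖u.pathProd e l e‖ :=
        (norm_trace_le_card_mul_norm _).trans_eq (by rw [Fintype.card_fin])
    _ ≤ (∑ e, r e : ℕ) * δ ^ (e :: l).length :=
        mul_le_mul (mod_cast Finset.single_le_sum (fun _ _ => Nat.zero_le _) (Finset.mem_univ e))
          (norm_pathProd_le hδ e e l) (norm_nonneg _) (Nat.cast_nonneg _)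

theorem summable_wordTrace_div_length (hδ : ∀ e e', ‖u.block e e'‖ ≤ δ) (hδ₀ : 0 ≤ δ)
    (hcard : Fintype.card H.DirEdge * δ < 1) :
    Summable fun c : List H.DirEdge => u.wordTrace c / c.length := by
  refine .of_norm_bounded (g := fun c => (∑ e, r e : ℕ) * δ ^ c.length)
    ((summable_pow_length hδ₀ hcard).mul_left _) fun c => ?_
  refine le_trans ?_ (norm_wordTrace_le hδ c)
  rcases c with _ | ⟨e, l⟩
  · simp [wordTrace]
  rw [norm_div, Complex.norm_natCast]
  exact div_le_self (norm_nonneg _) (mod_cast Nat.succ_pos l.length)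

end Norm

section EulerProduct

variable {u}

theorem hasSum_wordTrace_div_length
    (hu : Summable fun c : List H.DirEdge => u.wordTrace c / c.length) :
    HasSum (fun c : List H.DirEdge => u.wordTrace c / c.length) (traceLog u.edgeMatrix) := by
  have hlen := hasSum_sum_ofFn hu.hasSum
  have htrace : ∀ k : ℕ, ∑ v : Fin (k + 1) → H.DirEdge,
      u.wordTrace (List.ofFn v) / (List.ofFn v).length =
        (u.edgeMatrix ^ (k + 1)).trace / (k + 1) := fun k => by
    simp only [List.length_ofFn, Nat.cast_succ, ← Finset.sum_div, sum_wordTrace_eq_trace_pow]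
  rw [← hasSum_nat_add_iff' 1] at hlen
  simp only [htrace, Finset.range_one, Finset.sum_singleton, List.ofFn_zero, List.length_nil,
    Nat.cast_zero, div_zero, Finset.sum_const_zero, sub_zero] at hlen
  rw [traceLog, hlen.tsum_eq]
  exact hu.hasSum

theorem hasSum_wordTrace_toGeodesic
    (hu : Summable fun c : List H.DirEdge => u.wordTrace c / c.length) :
    HasSum (fun t => u.wordTrace (PrimeCycle.toGeodesic t) / (PrimeCycle.toGeodesic t).length)
      (traceLog u.edgeMatrix) := by
  refine (PrimeCycle.toGeodesic_injective.hasSum_iff (f := fun c => u.wordTrace c / c.length)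
    fun c hc => ?_).2 (hasSum_wordTrace_div_length hu)
  have hzero : u.wordTrace c = 0 := not_not.1 fun h =>
    hc (isClosedGeodesic_of_wordTrace_ne_zero h).mem_range_toGeodesic
  rw [hzero, zero_div]

variable (u) in
/-- The series `∑_{m ≥ 1} tr (π ^ m) / m` for `-log det (I - π)`, with `π` the product of the
weights along the given geodesic. -/
noncomputable def geodesicTraceLog : List H.DirEdge → ℂ
  | [] => 0
  | e :: l => traceLog (u.pathProd e l e)

open scoped Matrix.Norms.Operator in
theorem exp_geodesicTraceLog {δ : ℝ} (hδ : ∀ e e', ‖u.block e e'‖ ≤ δ) (hδ₀ : 0 ≤ δ)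
    (hδ₁ : δ < 1) (c : List H.DirEdge) :
    Complex.exp (u.geodesicTraceLog c) = (u.geodesicDet c)⁻¹ := by
  rcases c with _ | ⟨e, l⟩
  · simp [geodesicTraceLog, geodesicDet]
  · exact exp_traceLog (norm_lt_one_of_mem_roots_charpoly
      ((norm_pathProd_le hδ e e l).trans_lt (pow_lt_one₀ hδ₀ hδ₁ l.length.succ_ne_zero)))

-- The `|c|` rotations of `c ^ (m + 1)` have equal traces, and this cancels the factor `|c|` of the
-- length `(m + 1) |c|`.
theorem sum_wordTrace_rotate_wordPow_succ (e : H.DirEdge) (l : List H.DirEdge) (m : ℕ) :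
    ∑ i : Fin (e :: l).length, u.wordTrace (wordPow ((e :: l).rotate i) (m + 1)) /
        (wordPow ((e :: l).rotate i) (m + 1)).length =
      (u.pathProd e l e ^ (m + 1)).trace / (m + 1) := by
  have hlen : ((e :: l).length : ℂ) ≠ 0 := Nat.cast_ne_zero.2 l.length.succ_ne_zero
  simp only [length_wordPow, List.length_rotate, ← rotate_wordPow, wordTrace_rotate,
    wordTrace_wordPow_succ, Finset.sum_const, Finset.card_univ, Fintype.card_fin, nsmul_eq_mul,
    Nat.cast_mul, Nat.cast_succ (n := m)]
  have hm : (m + 1 : ℂ) ≠ 0 := Nat.cast_add_one_ne_zero m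
  field_simp

theorem hasSum_wordTrace_rotate_wordPow {c : List H.DirEdge} (hc : c ≠ [])
    (hs : Summable fun t : ℕ × Fin c.length => u.wordTrace (wordPow (c.rotate t.2) (t.1 + 1)) /
      (wordPow (c.rotate t.2) (t.1 + 1)).length) :
    HasSum (fun t : ℕ × Fin c.length => u.wordTrace (wordPow (c.rotate t.2) (t.1 + 1)) /
      (wordPow (c.rotate t.2) (t.1 + 1)).length) (u.geodesicTraceLog c) := by
  obtain ⟨e, l, rfl⟩ := List.exists_cons_of_ne_nil hc
  have hfiber := hs.hasSum.prod_fiberwise fun m => hasSum_fintype _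
  simp only [sum_wordTrace_rotate_wordPow_succ] at hfiber
  rw [geodesicTraceLog, traceLog, hfiber.tsum_eq]
  exact hs.hasSum

open scoped Matrix.Norms.Operator in
theorem hasProd_inv_cycleDet {δ : ℝ} (hδ : ∀ e e', ‖u.block e e'‖ ≤ δ) (hδ₀ : 0 ≤ δ)
    (hδ₁ : δ < 1) (hcard : Fintype.card H.DirEdge * δ < 1) (hM : ‖u.edgeMatrix‖ < 1) :
    HasProd (fun p : H.PrimeCycle => (u.cycleDet p)⁻¹) ((1 - u.edgeMatrix).det)⁻¹ := by
  have hsum := hasSum_wordTrace_toGeodesic (summable_wordTrace_div_length hδ hδ₀ hcard)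
  have hcycle : HasSum (fun p : H.PrimeCycle => u.geodesicTraceLog p.rep)
      (traceLog u.edgeMatrix) :=
    hsum.sigma fun p => hasSum_wordTrace_rotate_wordPow p.isPrimeGeodesic_rep.1.1
      (hsum.summable.sigma_factor p)
  have hexp := hcycle.cexp
  rw [exp_traceLog (norm_lt_one_of_mem_roots_charpoly hM)] at hexp
  simp only [Function.comp_def, exp_geodesicTraceLog hδ hδ₀ hδ₁] at hexp
  exact hexp

end EulerProduct

end Weight

open scoped Matrix.Norms.Operator in
theorem eventually_hasProd_inv_cycleDet (H : FinHypergraph V) (r : H.DirEdge → ℕ) :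
    ∀ᶠ u in 𝓝 (0 : H.Weight r),
      HasProd (fun p : H.PrimeCycle => (u.cycleDet p)⁻¹) ((1 - u.edgeMatrix).det)⁻¹ := by
  obtain ⟨δ, hδ₀, hδ⟩ : ∃ δ : ℝ, 0 < δ ∧ (Fintype.card H.DirEdge + 1 : ℝ) * δ < 1 :=
    ⟨(Fintype.card H.DirEdge + 2 : ℝ)⁻¹, by positivity, by
      rw [← div_eq_mul_inv, div_lt_one (by positivity)]; linarith⟩
  have hblock : ∀ e e', ∀ᶠ u in 𝓝 (0 : H.Weight r), ‖u.block e e'‖ < δ := fun e e' => by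
    have hcont : Continuous fun u : H.Weight r => ‖u.block e e'‖ := continuous_norm.comp
      (continuous_matrix fun k l => (Weight.contDiff_block_apply (m := 0) e e' k l).continuous)
    exact hcont.continuousAt.eventually_lt_const (by simpa only [Weight.block_zero, norm_zero])
  have hM : ∀ᶠ u in 𝓝 (0 : H.Weight r), ‖u.edgeMatrix‖ < 1 := by
    have hcont : Continuous fun u : H.Weight r => ‖u.edgeMatrix‖ := continuous_norm.comp
      (continuous_matrix fun a b =>
        (Weight.contDiff_block_apply (m := 0) a.1 b.1 a.2 b.2).continuous)
    exact hcont.continuousAt.eventually_lt_const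
      (by simp only [Weight.edgeMatrix_zero, norm_zero, one_pos])
  filter_upwards [Filter.eventually_all.2 fun e => Filter.eventually_all.2 (hblock e), hM]
    with u hu hMu
  rw [add_one_mul] at hδ
  exact Weight.hasProd_inv_cycleDet (fun e e' => (hu e e').le) hδ₀.le
    ((le_add_of_nonneg_left (by positivity)).trans_lt hδ)
    ((le_add_of_nonneg_right hδ₀.le).trans_lt hδ) hMu

open scoped ContDiff in
theorem analyticOnNhd_det_one_sub_edgeMatrix (H : FinHypergraph V) (r : H.DirEdge → ℕ) :
    AnalyticOnNhd ℂ (fun u : H.Weight r => (1 - u.edgeMatrix).det) Set.univ := by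
  rw [← contDiff_omega_iff_analyticOnNhd]
  simp only [Matrix.det_apply, Matrix.sub_apply]
  exact ContDiff.sum fun σ _ => .const_smul _ <| contDiff_prod fun a _ =>
    contDiff_const.sub (Weight.contDiff_block_apply _ _ _ _)

theorem isReciprocalZeta_det (H : FinHypergraph V) (r : H.DirEdge → ℕ) :
    H.IsReciprocalZeta r fun u => (1 - u.edgeMatrix).det := by
  refine ⟨analyticOnNhd_det_one_sub_edgeMatrix H r, ?_⟩
  filter_upwards [eventually_hasProd_inv_cycleDet H r] with u hu
  exact ⟨hu.multipliable, by rw [Weight.eulerProduct, hu.tprod_eq, inv_inv]⟩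

theorem IsReciprocalZeta.eq_det {Z : H.Weight r → ℂ} (hZ : H.IsReciprocalZeta r Z) :
    Z = fun u => (1 - u.edgeMatrix).det := by
  refine hZ.1.eq_of_eventuallyEq (isReciprocalZeta_det H r).1 (z₀ := 0) ?_
  filter_upwards [hZ.2, (isReciprocalZeta_det H r).2] with u hZu hdet
  rw [hZu.2, hdet.2]

end FinHypergraph

/-! ### Moments of exponential families -/

/-- The pairing `v ↦ (w ↦ ⟨v, w⟩)` as a continuous bilinear map, in which the derivatives with
respect to the parameters are expressed. -/
noncomputable def dotCLM (ι : Type*) [Fintype ι] : (ι → ℝ) →L[ℝ] (ι → ℝ) →L[ℝ] ℝ :=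
  (dotProductBilin ℝ ℝ).toContinuousBilinearMap

theorem dotCLM_apply {ι : Type*} [Fintype ι] (v w : ι → ℝ) : dotCLM ι v w = v ⬝ᵥ w := rfl

theorem abs_dotProduct_le {ι : Type*} [Fintype ι] (v w : ι → ℝ) :
    |v ⬝ᵥ w| ≤ ‖v‖ * ∑ k, |w k| := by
  rw [dotProduct, Finset.mul_sum]
  refine (Finset.abs_sum_le_sum_abs _ _).trans (Finset.sum_le_sum fun k _ => ?_)
  rw [abs_mul]
  gcongr
  exact norm_le_pi_norm v k

theorem norm_dotCLM_le {ι : Type*} [Fintype ι] (v : ι → ℝ) : ‖dotCLM ι v‖ ≤ ∑ k, |v k| := by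
  refine ContinuousLinearMap.opNorm_le_bound _ (Finset.sum_nonneg fun _ _ => abs_nonneg _)
    fun w => ?_
  rw [dotCLM_apply, dotProduct_comm, mul_comm]
  exact abs_dotProduct_le w v

namespace ExpFamily

variable {X : Type*} [MeasurableSpace X] {ι : Type*} [Fintype ι]

section Moments

variable (E : ExpFamily X ι)

/-- The `ℓ¹` norm of the sufficient statistic. -/
def statNorm (x : X) : ℝ := ∑ k, |E.stat x k|

/-- Measurable functions that are `O(exp (ε ‖φ‖))` for every `ε > 0`. Their moments are smooth in
the parameter, and they form an algebra that contains the components of `φ`. -/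
structure IsSubexp (g : X → ℝ) : Prop where
  measurable : Measurable g
  bound : ∀ ε > 0, ∃ C, ∀ x, |g x| ≤ C * Real.exp (ε * E.statNorm x)

/-- The unnormalized moment `∫ g(x) exp ⟨θ, φ(x)⟩ dν(x)`. -/
noncomputable def moment (g : X → ℝ) (θ : ι → ℝ) : ℝ :=
  ∫ x, g x * Real.exp (θ ⬝ᵥ E.stat x) ∂E.base

variable {E} {g h : X → ℝ} {θ : ι → ℝ}

theorem statNorm_nonneg (x : X) : 0 ≤ E.statNorm x :=
  Finset.sum_nonneg fun _ _ => abs_nonneg _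

theorem isOpen_paramSet : IsOpen E.paramSet := isOpen_interior

theorem isSubexp_const (c : ℝ) : E.IsSubexp fun _ => c := by
  refine ⟨measurable_const, fun ε hε => ⟨|c|, fun x => ?_⟩⟩
  exact le_mul_of_one_le_right (abs_nonneg _)
    (Real.one_le_exp (mul_nonneg hε.le (statNorm_nonneg x)))

theorem IsSubexp.mono (hh : E.IsSubexp h) (hg : Measurable g) (hle : ∀ x, |g x| ≤ |h x|) :
    E.IsSubexp g :=
  ⟨hg, fun ε hε => (hh.bound ε hε).imp fun _ hC x => (hle x).trans (hC x)⟩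

theorem IsSubexp.mul (hg : E.IsSubexp g) (hh : E.IsSubexp h) :
    E.IsSubexp fun x => g x * h x := by
  refine ⟨hg.measurable.mul hh.measurable, fun ε hε => ?_⟩
  obtain ⟨C, hC⟩ := hg.bound (ε / 2) (half_pos hε)
  obtain ⟨D, hD⟩ := hh.bound (ε / 2) (half_pos hε)
  refine ⟨C * D, fun x => ?_⟩
  calc |g x * h x| = |g x| * |h x| := abs_mul _ _
    _ ≤ (C * Real.exp (ε / 2 * E.statNorm x)) * (D * Real.exp (ε / 2 * E.statNorm x)) :=
        mul_le_mul (hC x) (hD x) (abs_nonneg _) ((abs_nonneg _).trans (hC x))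
    _ = C * D * Real.exp (ε * E.statNorm x) := by
        rw [mul_mul_mul_comm, ← Real.exp_add, ← add_mul, add_halves]

variable (hφ : Measurable E.stat)

include hφ

theorem measurable_dotProduct_stat (θ : ι → ℝ) : Measurable fun x => θ ⬝ᵥ E.stat x :=
  ((dotCLM ι θ).continuous.measurable).comp hφ

theorem measurable_statNorm : Measurable E.statNorm := by
  unfold statNorm
  fun_prop

theorem isSubexp_statNorm : E.IsSubexp E.statNorm := by
  refine ⟨measurable_statNorm hφ, fun ε hε => ⟨ε⁻¹, fun x => ?_⟩⟩
  rw [abs_of_nonneg (statNorm_nonneg x), ← div_eq_inv_mul, le_div_iff₀ hε, mul_comm]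
  exact (le_add_of_nonneg_right zero_le_one).trans (Real.add_one_le_exp _)

theorem isSubexp_stat (k : ι) : E.IsSubexp fun x => E.stat x k :=
  (isSubexp_statNorm hφ).mono (by fun_prop) fun x => by
    rw [abs_of_nonneg (statNorm_nonneg x)]
    exact Finset.single_le_sum (f := fun k => |E.stat x k|) (fun _ _ => abs_nonneg _)
      (Finset.mem_univ k)

theorem integrable_exp_of_partition_lt_top (h : E.partition θ < ⊤) :
    Integrable (fun x => Real.exp (θ ⬝ᵥ E.stat x)) E.base := by
  refine ⟨(measurable_dotProduct_stat hφ θ).exp.aestronglyMeasurable, ?_⟩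
  rw [hasFiniteIntegral_iff_ofReal (.of_forall fun _ => (Real.exp_pos _).le)]
  exact h

theorem integrable_exp (hθ : θ ∈ E.paramSet) :
    Integrable (fun x => Real.exp (θ ⬝ᵥ E.stat x)) E.base :=
  integrable_exp_of_partition_lt_top hφ (interior_subset (s := {θ | E.partition θ < ⊤}) hθ)

omit hφ in
-- `ε ‖φ‖₁ = ⟨s, φ⟩` for the vector `s` of signs of the components of `φ`, scaled by `ε`.
theorem exp_add_mul_statNorm_le [DecidableEq ι] (θ : ι → ℝ) (ε : ℝ) (x : X) :
    Real.exp (θ ⬝ᵥ E.stat x + ε * E.statNorm x) ≤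
      ∑ b : ι → Bool, Real.exp ((θ + fun k => bif b k then ε else -ε) ⬝ᵥ E.stat x) := by
  let b : ι → Bool := fun k => decide (0 ≤ E.stat x k)
  have hsign : ε * E.statNorm x = (fun k => bif b k then ε else -ε) ⬝ᵥ E.stat x := by
    rw [statNorm, Finset.mul_sum, dotProduct]
    refine Finset.sum_congr rfl fun k _ => ?_
    rcases le_or_gt 0 (E.stat x k) with h | h
    · simp [b, h, abs_of_nonneg h]
    · simp [b, h.not_ge, abs_of_neg h]
  rw [hsign, ← add_dotProduct]
  exact Finset.single_le_sum
    (f := fun b : ι → Bool => Real.exp ((θ + fun k => bif b k then ε else -ε) ⬝ᵥ E.stat x))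
    (fun _ _ => (Real.exp_pos _).le) (Finset.mem_univ b)

theorem exists_integrable_exp_add_mul_statNorm (hθ : θ ∈ E.paramSet) :
    ∃ ε > 0, Integrable (fun x => Real.exp (θ ⬝ᵥ E.stat x + ε * E.statNorm x)) E.base := by
  classical
  obtain ⟨ε, hε, hball⟩ := Metric.mem_nhds_iff.1 (mem_interior_iff_mem_nhds.1 hθ)
  refine ⟨ε / 2, half_pos hε, ?_⟩
  have hcorner : ∀ b : ι → Bool,
      E.partition (θ + fun k => bif b k then ε / 2 else -(ε / 2)) < ⊤ := fun b => by
    refine hball (mem_ball_iff_norm.2 ?_)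
    rw [add_sub_cancel_left]
    refine ((pi_norm_le_iff_of_nonneg (half_pos hε).le).2 fun k => ?_).trans_lt (half_lt_self hε)
    cases b k <;> simp [abs_of_pos hε]
  refine Integrable.mono' (integrable_finsetSum Finset.univ fun b _ =>
    integrable_exp_of_partition_lt_top hφ (hcorner b)) ?_ (.of_forall fun x => ?_)
  · exact ((measurable_dotProduct_stat hφ θ).add
      ((measurable_statNorm hφ).const_mul _)).exp.aestronglyMeasurable
  · rw [Real.norm_eq_abs, Real.abs_exp]
    exact exp_add_mul_statNorm_le θ (ε / 2) x

theorem IsSubexp.integrable (hg : E.IsSubexp g) (hθ : θ ∈ E.paramSet) :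
    Integrable (fun x => g x * Real.exp (θ ⬝ᵥ E.stat x)) E.base := by
  obtain ⟨ε, hε, hint⟩ := exists_integrable_exp_add_mul_statNorm hφ hθ
  obtain ⟨C, hC⟩ := hg.bound ε hε
  refine (hint.const_mul C).mono'
    (hg.measurable.mul (measurable_dotProduct_stat hφ θ).exp).aestronglyMeasurable
    (.of_forall fun x => ?_)
  rw [Real.norm_eq_abs, abs_mul, Real.abs_exp, add_comm, Real.exp_add, ← mul_assoc]
  exact mul_le_mul_of_nonneg_right (hC x) (Real.exp_pos _).le

omit hφ in
theorem hasFDerivAt_exp_dotProduct_stat (θ : ι → ℝ) (x : X) :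
    HasFDerivAt (fun θ => Real.exp (θ ⬝ᵥ E.stat x))
      (Real.exp (θ ⬝ᵥ E.stat x) • dotCLM ι (E.stat x)) θ := by
  have hdot : HasFDerivAt (fun θ => θ ⬝ᵥ E.stat x) (dotCLM ι (E.stat x)) θ :=
    (dotCLM ι (E.stat x)).hasFDerivAt.congr_of_eventuallyEq
      (.of_forall fun θ => dotProduct_comm θ (E.stat x))
  exact hdot.exp

omit hφ in
theorem norm_exp_smul_dotCLM_le {C ε : ℝ} {θ' : ι → ℝ} {x : X} (hθ' : ‖θ' - θ‖ ≤ ε)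
    (hC : |g x * E.statNorm x| ≤ C * Real.exp (ε * E.statNorm x)) :
    ‖g x • Real.exp (θ' ⬝ᵥ E.stat x) • dotCLM ι (E.stat x)‖ ≤
      C * Real.exp (θ ⬝ᵥ E.stat x + 2 * ε * E.statNorm x) := by
  have hdot : θ' ⬝ᵥ E.stat x ≤ θ ⬝ᵥ E.stat x + ε * E.statNorm x := by
    have hle : (θ' - θ) ⬝ᵥ E.stat x ≤ ε * E.statNorm x :=
      (le_abs_self _).trans <| (abs_dotProduct_le (θ' - θ) (E.stat x)).trans <|
        mul_le_mul_of_nonneg_right hθ' (statNorm_nonneg x)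
    rw [sub_dotProduct] at hle
    linarith
  rw [abs_mul, abs_of_nonneg (statNorm_nonneg x)] at hC
  calc ‖g x • Real.exp (θ' ⬝ᵥ E.stat x) • dotCLM ι (E.stat x)‖
      = |g x| * ‖dotCLM ι (E.stat x)‖ * Real.exp (θ' ⬝ᵥ E.stat x) := by
        rw [norm_smul, norm_smul, Real.norm_eq_abs, Real.norm_eq_abs, Real.abs_exp]; ring
    _ ≤ C * Real.exp (ε * E.statNorm x) * Real.exp (θ ⬝ᵥ E.stat x + ε * E.statNorm x) :=
        mul_le_mul ((mul_le_mul_of_nonneg_left (norm_dotCLM_le _) (abs_nonneg _)).trans hC)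
          (Real.exp_le_exp.2 hdot) (Real.exp_pos _).le
          ((mul_nonneg (abs_nonneg _) (statNorm_nonneg x)).trans hC)
    _ = C * Real.exp (θ ⬝ᵥ E.stat x + 2 * ε * E.statNorm x) := by
        rw [mul_assoc, ← Real.exp_add]; ring_nf

theorem IsSubexp.integral_smul_dotCLM (hg : E.IsSubexp g) (hθ : θ ∈ E.paramSet) :
    ∫ x, g x • Real.exp (θ ⬝ᵥ E.stat x) • dotCLM ι (E.stat x) ∂E.base =
      dotCLM ι fun k => E.moment (fun x => g x * E.stat x k) θ := by
  have hcoord : ∀ k, Integrable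
      (fun x => (g x • Real.exp (θ ⬝ᵥ E.stat x) • E.stat x) k) E.base := fun k => by
    simpa only [Pi.smul_apply, smul_eq_mul, mul_assoc, mul_comm (E.stat _ k)]
      using (hg.mul (isSubexp_stat hφ k)).integrable hφ hθ
  simp only [← map_smul]
  rw [(dotCLM ι).integral_comp_comm (.of_eval hcoord)]
  congr 1
  ext k
  rw [eval_integral hcoord]
  simp only [moment, Pi.smul_apply, smul_eq_mul, mul_assoc, mul_comm (E.stat _ k)]

theorem IsSubexp.hasFDerivAt_moment (hg : E.IsSubexp g) (hθ : θ ∈ E.paramSet) :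
    HasFDerivAt (E.moment g) (dotCLM ι fun k => E.moment (fun x => g x * E.stat x k) θ) θ := by
  obtain ⟨ε, hε, hint⟩ := exists_integrable_exp_add_mul_statNorm hφ hθ
  obtain ⟨C, hC⟩ := (hg.mul (isSubexp_statNorm hφ)).bound (ε / 2) (half_pos hε)
  have hmeas : ∀ θ', AEStronglyMeasurable (fun x => g x * Real.exp (θ' ⬝ᵥ E.stat x)) E.base :=
    fun θ' => (hg.measurable.mul (measurable_dotProduct_stat hφ θ').exp).aestronglyMeasurable
  rw [← hg.integral_smul_dotCLM hφ hθ]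
  refine hasFDerivAt_integral_of_dominated_of_fderiv_le
    (bound := fun x => C * Real.exp (θ ⬝ᵥ E.stat x + ε * E.statNorm x))
    (Metric.ball_mem_nhds θ (half_pos hε)) (.of_forall hmeas) (hg.integrable hφ hθ) ?_
    (.of_forall fun x θ' hθ' => ?_) (hint.const_mul C)
    (.of_forall fun x θ' _ => (hasFDerivAt_exp_dotProduct_stat θ' x).const_mul (g x))
  · simp only [← smul_assoc]
    exact (hmeas θ).smul ((dotCLM ι).continuous.comp_aestronglyMeasurable hφ.aestronglyMeasurable)
  · simpa only [mul_div_cancel₀ ε two_ne_zero]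
      using norm_exp_smul_dotCLM_le (mem_ball_iff_norm.1 hθ').le (hC x)

theorem IsSubexp.contDiffOn_moment (hg : E.IsSubexp g) (n : ℕ) :
    ContDiffOn ℝ n (E.moment g) E.paramSet := by
  induction n generalizing g with
  | zero =>
    exact contDiffOn_zero.2 fun θ hθ =>
      (hg.hasFDerivAt_moment hφ hθ).continuousAt.continuousWithinAt
  | succ n ih =>
    rw [Nat.cast_succ, contDiffOn_succ_iff_fderiv_of_isOpen isOpen_paramSet]
    refine ⟨fun θ hθ => (hg.hasFDerivAt_moment hφ hθ).differentiableAt.differentiableWithinAt,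
      fun h => absurd h (by simp), ?_⟩
    exact ((dotCLM ι).contDiff.comp_contDiffOn <| contDiffOn_pi.2 fun k =>
      ih (hg.mul (isSubexp_stat hφ k))).congr fun θ hθ => (hg.hasFDerivAt_moment hφ hθ).fderiv

theorem IsSubexp.contDiffAt_moment (hg : E.IsSubexp g) (hθ : θ ∈ E.paramSet) (n : ℕ) :
    ContDiffAt ℝ n (E.moment g) θ :=
  (hg.contDiffOn_moment hφ n).contDiffAt (isOpen_paramSet.mem_nhds hθ)

end Moments

end ExpFamily

/-! ### Cumulants and the Legendre transform -/

theorem hessian_eq_transpose {κ : Type*} [Fintype κ] [DecidableEq κ] {f : (κ → ℝ) → ℝ}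
    {g : (κ → ℝ) → κ → ℝ} {x : κ → ℝ} {A : Matrix κ κ ℝ}
    (hf : fderiv ℝ f =ᶠ[𝓝 x] fun y => dotCLM κ (g y))
    (hg : HasFDerivAt g (toLin' A).toContinuousLinearMap x) : hessian f x = Aᵀ := by
  have hderiv := ((dotCLM κ).hasFDerivAt.comp x hg).fderiv
  ext a b
  rw [hessian, Matrix.of_apply, hf.fderiv_eq]
  change fderiv ℝ (dotCLM κ ∘ g) x _ _ = _
  rw [hderiv, ContinuousLinearMap.comp_apply, dotCLM_apply]
  simp

namespace ExpFamily

variable {X : Type*} [MeasurableSpace X] {ι : Type*} [Fintype ι] {E : ExpFamily X ι}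
  {g h : X → ℝ} {θ θ' : ι → ℝ}

theorem isSymm_varMatrix {κ : Type*} (μ : Measure X) (f : X → κ → ℝ) :
    (varMatrix μ f).IsSymm :=
  Matrix.IsSymm.ext fun _ _ => covariance_comm _ _

variable (hφ : Measurable E.stat)

include hφ

theorem logPartition_eq_log_integral_exp (θ : ι → ℝ) :
    E.logPartition θ = Real.log (∫ x, Real.exp (θ ⬝ᵥ E.stat x) ∂E.base) := by
  rw [logPartition, partition, integral_eq_lintegral_of_nonneg_ae
    (.of_forall fun _ => (Real.exp_pos _).le)
    (measurable_dotProduct_stat hφ θ).exp.aestronglyMeasurable]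

variable (hν : E.base ≠ 0)

include hν

theorem integral_exp_pos (hθ : θ ∈ E.paramSet) :
    0 < ∫ x, Real.exp (θ ⬝ᵥ E.stat x) ∂E.base :=
  haveI : NeZero E.base := ⟨hν⟩
  MeasureTheory.integral_exp_pos (integrable_exp hφ hθ)

theorem exp_logPartition (hθ : θ ∈ E.paramSet) :
    Real.exp (E.logPartition θ) = ∫ x, Real.exp (θ ⬝ᵥ E.stat x) ∂E.base := by
  rw [logPartition_eq_log_integral_exp hφ, Real.exp_log (integral_exp_pos hφ hν hθ)]

theorem law_eq_tilted (hθ : θ ∈ E.paramSet) :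
    E.law θ = E.base.tilted fun x => θ ⬝ᵥ E.stat x := by
  simp only [law, Measure.tilted, density, Real.exp_sub, exp_logPartition hφ hν hθ]

theorem isProbabilityMeasure_law (hθ : θ ∈ E.paramSet) : IsProbabilityMeasure (E.law θ) := by
  have : NeZero E.base := ⟨hν⟩
  rw [law_eq_tilted hφ hν hθ]
  exact isProbabilityMeasure_tilted (integrable_exp hφ hθ)

theorem integral_law (hθ : θ ∈ E.paramSet) (g : X → ℝ) :
    ∫ x, g x ∂E.law θ = E.moment g θ / E.moment (fun _ => 1) θ := by
  simp only [law_eq_tilted hφ hν hθ, integral_tilted, moment, one_mul, smul_eq_mul,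
    div_mul_eq_mul_div, mul_comm (g _), integral_div]

theorem integral_exp_sub_law (hθ : θ ∈ E.paramSet) (hθ' : θ' ∈ E.paramSet) :
    ∫ x, Real.exp ((θ' - θ) ⬝ᵥ E.stat x) ∂E.law θ =
      Real.exp (E.logPartition θ' - E.logPartition θ) := by
  rw [law_eq_tilted hφ hν hθ, integral_exp_tilted, Real.exp_sub, exp_logPartition hφ hν hθ,
    exp_logPartition hφ hν hθ']
  simp only [Pi.add_apply, ← add_dotProduct, add_sub_cancel]

theorem integrable_exp_sub_law (hθ : θ ∈ E.paramSet) (hθ' : θ' ∈ E.paramSet) :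
    Integrable (fun x => Real.exp ((θ' - θ) ⬝ᵥ E.stat x)) (E.law θ) := by
  rw [law_eq_tilted hφ hν hθ, integrable_tilted_iff (integrable_exp hφ hθ)]
  simpa only [smul_eq_mul, ← Real.exp_add, ← add_dotProduct, add_sub_cancel]
    using integrable_exp hφ hθ'

theorem IsSubexp.integrable_law (hg : E.IsSubexp g) (hθ : θ ∈ E.paramSet) :
    Integrable g (E.law θ) := by
  rw [law_eq_tilted hφ hν hθ, integrable_tilted_iff (integrable_exp hφ hθ)]
  simpa only [smul_eq_mul, mul_comm] using hg.integrable hφ hθ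

theorem IsSubexp.memLp_two_law (hg : E.IsSubexp g) (hθ : θ ∈ E.paramSet) :
    MemLp g 2 (E.law θ) := by
  rw [memLp_two_iff_integrable_sq hg.measurable.aestronglyMeasurable]
  simpa only [sq] using (hg.mul hg).integrable_law hφ hν hθ

theorem moment_one_ne_zero (hθ : θ ∈ E.paramSet) : E.moment (fun _ => 1) θ ≠ 0 := by
  simpa only [moment, one_mul] using (integral_exp_pos hφ hν hθ).ne'

theorem IsSubexp.covariance_law (hg : E.IsSubexp g) (hh : E.IsSubexp h) (hθ : θ ∈ E.paramSet) :
    cov[g, h; E.law θ] = E.moment (fun x => g x * h x) θ / E.moment (fun _ => 1) θ -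
      E.moment g θ / E.moment (fun _ => 1) θ * (E.moment h θ / E.moment (fun _ => 1) θ) := by
  have := isProbabilityMeasure_law hφ hν hθ
  simp only [covariance_eq_sub (hg.memLp_two_law hφ hν hθ) (hh.memLp_two_law hφ hν hθ),
    integral_law hφ hν hθ, Pi.mul_apply]

theorem IsSubexp.hasFDerivAt_integral_law (hg : E.IsSubexp g) (hθ : θ ∈ E.paramSet) :
    HasFDerivAt (fun θ => ∫ x, g x ∂E.law θ)
      (dotCLM ι fun k => cov[g, fun x => E.stat x k; E.law θ]) θ := by
  have hZ := moment_one_ne_zero hφ hν hθ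
  have hdiv := (hg.hasFDerivAt_moment hφ hθ).mul
    ((hasDerivAt_inv hZ).comp_hasFDerivAt θ ((isSubexp_const 1).hasFDerivAt_moment hφ hθ))
  refine (hdiv.congr_fderiv ?_).congr_of_eventuallyEq ?_
  · simp only [Function.comp_apply, ← map_smul, ← map_add, one_mul]
    congr 1
    ext k
    rw [hg.covariance_law hφ hν (isSubexp_stat hφ k) hθ]
    simp only [Pi.add_apply, Pi.smul_apply, smul_eq_mul]
    field_simp
    ring
  · filter_upwards [isOpen_paramSet.mem_nhds hθ] with θ' hθ'
    exact integral_law hφ hν hθ' g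

theorem hasFDerivAt_logPartition (hθ : θ ∈ E.paramSet) :
    HasFDerivAt E.logPartition (dotCLM ι (E.meanMap θ)) θ := by
  have hlog := ((isSubexp_const 1).hasFDerivAt_moment hφ hθ).log (moment_one_ne_zero hφ hν hθ)
  simp only [moment, one_mul, ← logPartition_eq_log_integral_exp hφ] at hlog
  refine hlog.congr_fderiv ?_
  rw [← map_smul]
  congr 1
  ext k
  simp only [meanMap, integral_law hφ hν hθ, moment, one_mul, Pi.smul_apply, smul_eq_mul,
    div_eq_inv_mul]

theorem contDiffAt_logPartition (hθ : θ ∈ E.paramSet) (n : ℕ) :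
    ContDiffAt ℝ n E.logPartition θ := by
  have hlog := ((isSubexp_const 1).contDiffAt_moment hφ hθ n).log (moment_one_ne_zero hφ hν hθ)
  simpa only [moment, one_mul, ← logPartition_eq_log_integral_exp hφ] using hlog

theorem contDiffAt_meanMap (hθ : θ ∈ E.paramSet) (n : ℕ) : ContDiffAt ℝ n E.meanMap θ := by
  refine contDiffAt_pi.2 fun k => ?_
  refine (((isSubexp_stat hφ k).contDiffAt_moment hφ hθ n).div
    ((isSubexp_const 1).contDiffAt_moment hφ hθ n)
    (moment_one_ne_zero hφ hν hθ)).congr_of_eventuallyEq ?_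
  filter_upwards [isOpen_paramSet.mem_nhds hθ] with θ' hθ'
  exact integral_law hφ hν hθ' _

theorem hasFDerivAt_meanMap [DecidableEq ι] (hθ : θ ∈ E.paramSet) :
    HasFDerivAt E.meanMap (toLin' (varMatrix (E.law θ) E.stat)).toContinuousLinearMap θ :=
  hasFDerivAt_pi'.2 fun k => (isSubexp_stat hφ k).hasFDerivAt_integral_law hφ hν hθ

theorem hessian_logPartition [DecidableEq ι] (hθ : θ ∈ E.paramSet) :
    hessian E.logPartition θ = varMatrix (E.law θ) E.stat := by
  rw [hessian_eq_transpose ?_ (hasFDerivAt_meanMap hφ hν hθ), (isSymm_varMatrix _ _).eq]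
  filter_upwards [isOpen_paramSet.mem_nhds hθ] with θ' hθ'
  exact (hasFDerivAt_logPartition hφ hν hθ').fderiv

theorem varMatrix_law_mulVec (hθ : θ ∈ E.paramSet) (v : ι → ℝ) (k : ι) :
    (varMatrix (E.law θ) E.stat *ᵥ v) k =
      cov[fun x => E.stat x k, fun x => v ⬝ᵥ E.stat x; E.law θ] := by
  have := isProbabilityMeasure_law hφ hν hθ
  have hmem := fun a => (isSubexp_stat hφ a).memLp_two_law hφ hν hθ
  simp only [dotProduct]
  rw [covariance_fun_sum_right (fun a => (hmem a).const_mul (v a)) (hmem k)]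
  simp only [covariance_const_mul_right, mulVec, dotProduct, varMatrix, covMatrix,
    Matrix.of_apply, mul_comm]

theorem integrable_dotProduct_stat_law (hθ : θ ∈ E.paramSet) (v : ι → ℝ) :
    Integrable (fun x => v ⬝ᵥ E.stat x) (E.law θ) :=
  integrable_finsetSum _ fun k _ =>
    ((isSubexp_stat hφ k).integrable_law hφ hν hθ).const_mul (v k)

theorem integral_dotProduct_stat_law (hθ : θ ∈ E.paramSet) (v : ι → ℝ) :
    ∫ x, v ⬝ᵥ E.stat x ∂E.law θ = v ⬝ᵥ E.meanMap θ :=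
  (dotCLM ι v).integral_comp_comm
    (.of_eval fun k => (isSubexp_stat hφ k).integrable_law hφ hν hθ) |>.trans <|
    congrArg (v ⬝ᵥ ·) <| funext <|
      eval_integral fun k => (isSubexp_stat hφ k).integrable_law hφ hν hθ

-- Gibbs inequality: Jensen applied to the exponential of `(θ' - θ) ⬝ᵥ φ` under the law of `θ`.
theorem dotProduct_sub_logPartition_le (hθ : θ ∈ E.paramSet) (hθ' : θ' ∈ E.paramSet) :
    θ' ⬝ᵥ E.meanMap θ - E.logPartition θ' ≤ θ ⬝ᵥ E.meanMap θ - E.logPartition θ := by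
  have := isProbabilityMeasure_law hφ hν hθ
  have hJensen := convexOn_exp.map_integral_le Real.continuous_exp.continuousOn isClosed_univ
    (.of_forall fun _ => Set.mem_univ _) (integrable_dotProduct_stat_law hφ hν hθ (θ' - θ))
    (integrable_exp_sub_law hφ hν hθ hθ')
  rw [integral_dotProduct_stat_law hφ hν hθ, integral_exp_sub_law hφ hν hθ hθ',
    Real.exp_le_exp, sub_dotProduct] at hJensen
  linarith

theorem varMatrix_law_mulVec_eq_zero (hθ : θ ∈ E.paramSet) (hθ' : θ' ∈ E.paramSet)
    (heq : θ' ⬝ᵥ E.meanMap θ - E.logPartition θ' = θ ⬝ᵥ E.meanMap θ - E.logPartition θ) :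
    varMatrix (E.law θ) E.stat *ᵥ (θ' - θ) = 0 := by
  have := isProbabilityMeasure_law hφ hν hθ
  have hconst := (strictConvexOn_exp.ae_eq_const_or_map_average_lt
    Real.continuous_exp.continuousOn isClosed_univ (.of_forall fun _ => Set.mem_univ _)
    (integrable_dotProduct_stat_law hφ hν hθ (θ' - θ))
    (integrable_exp_sub_law hφ hν hθ hθ')).resolve_right fun hlt => by
      rw [average_eq_integral, average_eq_integral, integral_dotProduct_stat_law hφ hν hθ,
        integral_exp_sub_law hφ hν hθ hθ', Real.exp_lt_exp, sub_dotProduct] at hlt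
      linarith
  ext k
  rw [varMatrix_law_mulVec hφ hν hθ, covariance]
  refine (integral_congr_ae ?_).trans (integral_zero _ _)
  filter_upwards [hconst] with x hx
  rw [hx, Function.const_apply, average_eq_integral, sub_self, mul_zero]

theorem meanMap_injOn [DecidableEq ι]
    (hV : ∀ θ ∈ E.paramSet, IsUnit (varMatrix (E.law θ) E.stat)) :
    Set.InjOn E.meanMap E.paramSet := by
  intro θ hθ θ' hθ' hmean
  have hle := dotProduct_sub_logPartition_le hφ hν hθ hθ'
  have hge := dotProduct_sub_logPartition_le hφ hν hθ' hθ
  rw [← hmean] at hge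
  have hker := varMatrix_law_mulVec_eq_zero hφ hν hθ hθ' (hle.antisymm hge)
  refine (sub_eq_zero.1 (Matrix.mulVec_injective_of_isUnit (hV θ hθ) ?_)).symm
  exact hker.trans (mulVec_zero _).symm

theorem legendre_meanMap (hθ : θ ∈ E.paramSet) :
    E.legendre (E.meanMap θ) = θ ⬝ᵥ E.meanMap θ - E.logPartition θ := by
  have : Nonempty E.paramSet := ⟨⟨θ, hθ⟩⟩
  have hle : ∀ θ' : E.paramSet, θ'.1 ⬝ᵥ E.meanMap θ - E.logPartition θ'.1 ≤
      θ ⬝ᵥ E.meanMap θ - E.logPartition θ :=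
    fun θ' => dotProduct_sub_logPartition_le hφ hν hθ θ'.2
  exact le_antisymm (ciSup_le hle) (le_ciSup ⟨_, Set.forall_mem_range.2 hle⟩ ⟨θ, hθ⟩)

theorem exists_meanMap_localInverse [DecidableEq ι] (hθ : θ ∈ E.paramSet)
    (hV : IsUnit (varMatrix (E.law θ) E.stat)) :
    ∃ G : (ι → ℝ) → ι → ℝ, G (E.meanMap θ) = θ ∧ ContDiffAt ℝ 2 G (E.meanMap θ) ∧
      HasFDerivAt G (toLin' (varMatrix (E.law θ) E.stat)⁻¹).toContinuousLinearMap (E.meanMap θ) ∧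
      ∀ᶠ η in 𝓝 (E.meanMap θ), G η ∈ E.paramSet ∧ E.meanMap (G η) = η := by
  have hdet := (Matrix.isUnit_iff_isUnit_det _).1 hV
  let e : (ι → ℝ) ≃L[ℝ] (ι → ℝ) := (Matrix.toLin'OfInv (Matrix.nonsing_inv_mul _ hdet)
    (Matrix.mul_nonsing_inv _ hdet)).toContinuousLinearEquiv
  have hderiv : HasFDerivAt E.meanMap (e : (ι → ℝ) →L[ℝ] (ι → ℝ)) θ :=
    hasFDerivAt_meanMap hφ hν hθ
  have hΛ : ContDiffAt ℝ 2 E.meanMap θ := contDiffAt_meanMap hφ hν hθ 2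
  have hstrict := hΛ.hasStrictFDerivAt' hderiv two_ne_zero
  have hG := hΛ.to_localInverse hderiv two_ne_zero
  have hGθ := hΛ.localInverse_apply_image hderiv two_ne_zero
  refine ⟨hΛ.localInverse hderiv two_ne_zero, hGθ, hG, hstrict.to_localInverse.hasFDerivAt,
    .and (hG.continuousAt.eventually ?_) hstrict.eventually_right_inverse⟩
  rw [hGθ]
  exact isOpen_paramSet.mem_nhds hθ

variable {η : ι → ℝ} {G : (ι → ℝ) → ι → ℝ}

theorem legendre_eventuallyEq (hG : ∀ᶠ y in 𝓝 η, G y ∈ E.paramSet ∧ E.meanMap (G y) = y) :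
    E.legendre =ᶠ[𝓝 η] fun y => dotCLM ι (G y) y - E.logPartition (G y) := by
  filter_upwards [hG] with y ⟨hmem, hinv⟩
  simpa only [hinv, dotCLM_apply] using legendre_meanMap hφ hν hmem

theorem fderiv_legendre_eventuallyEq (hGdiff : ∀ᶠ y in 𝓝 η, DifferentiableAt ℝ G y)
    (hG : ∀ᶠ y in 𝓝 η, G y ∈ E.paramSet ∧ E.meanMap (G y) = y) :
    fderiv ℝ E.legendre =ᶠ[𝓝 η] fun y => dotCLM ι (G y) := by
  filter_upwards [(legendre_eventuallyEq hφ hν hG).eventually_nhds, hGdiff, hG]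
    with y hlegendre hdiff ⟨hmem, hinv⟩
  have hpairing : HasFDerivAt (fun y => dotCLM ι (G y) y) _ y :=
    ((dotCLM ι).hasFDerivAt.comp y hdiff.hasFDerivAt).clm_apply (hasFDerivAt_id y)
  have hderiv : HasFDerivAt (fun y => dotCLM ι (G y) y - E.logPartition (G y)) _ y :=
    hpairing.sub ((hasFDerivAt_logPartition hφ hν hmem).comp y hdiff.hasFDerivAt)
  rw [Filter.EventuallyEq.fderiv_eq hlegendre, hderiv.fderiv]
  ext1 w
  simp [dotCLM_apply, hinv, dotProduct_comm]

theorem contDiffAt_legendre [DecidableEq ι] (hθ : θ ∈ E.paramSet)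
    (hV : IsUnit (varMatrix (E.law θ) E.stat)) : ContDiffAt ℝ 2 E.legendre (E.meanMap θ) := by
  obtain ⟨G, hGθ, hGC, -, hG⟩ := exists_meanMap_localInverse hφ hν hθ hV
  have hψ : ContDiffAt ℝ 2 E.logPartition (G (E.meanMap θ)) :=
    hGθ.symm ▸ contDiffAt_logPartition hφ hν hθ 2
  exact ((((dotCLM ι).contDiff.contDiffAt.comp _ hGC).clm_apply contDiffAt_id).sub
    (hψ.comp _ hGC)).congr_of_eventuallyEq (legendre_eventuallyEq hφ hν hG)

theorem hessian_legendre [DecidableEq ι] (hθ : θ ∈ E.paramSet)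
    (hV : IsUnit (varMatrix (E.law θ) E.stat)) :
    hessian E.legendre (E.meanMap θ) = (varMatrix (E.law θ) E.stat)⁻¹ := by
  obtain ⟨G, -, hGC, hGderiv, hG⟩ := exists_meanMap_localInverse hφ hν hθ hV
  have hGdiff : ∀ᶠ y in 𝓝 (E.meanMap θ), DifferentiableAt ℝ G y :=
    (hGC.eventually (by simp)).mono fun y hy => hy.differentiableAt two_ne_zero
  rw [hessian_eq_transpose (fderiv_legendre_eventuallyEq hφ hν hGdiff hG) hGderiv,
    transpose_nonsing_inv, (isSymm_varMatrix _ _).eq]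

end ExpFamily

/-! ### Block matrices and the determinant identity -/

section BlockDiagonal

variable {o : Type*} [Fintype o] [DecidableEq o] {m : o → Type*} [∀ i, Fintype (m i)]
  {R : Type*} [CommRing R]

theorem blockDiagonal'_mul_apply {κ : Type*} (M : (i : o) → Matrix (m i) (m i) R)
    (B : Matrix (Σ i, m i) κ R) (i : o) (k : m i) (b : κ) :
    (blockDiagonal' M * B) ⟨i, k⟩ b = ∑ l, M i k l * B ⟨i, l⟩ b := by
  rw [mul_apply, Fintype.sum_sigma, Finset.sum_eq_single i]
  · simp only [blockDiagonal'_apply_eq]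
  · intro j _ hj
    simp only [blockDiagonal'_apply_ne M _ _ hj.symm, zero_mul, Finset.sum_const_zero]
  · exact fun hi => (hi (Finset.mem_univ i)).elim

theorem transpose_mul_blockDiagonal'_mul {κ : Type*} (M : (i : o) → Matrix (m i) (m i) R)
    (B : Matrix (Σ i, m i) κ R) :
    Bᵀ * blockDiagonal' M * B =
      ∑ i, (B.submatrix (Sigma.mk i) id)ᵀ * M i * B.submatrix (Sigma.mk i) id := by
  ext a b
  simp only [Matrix.sum_apply, Matrix.mul_assoc]
  rw [mul_apply, Fintype.sum_sigma]
  refine Finset.sum_congr rfl fun i _ => ?_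
  rw [mul_apply]
  refine Finset.sum_congr rfl fun k _ => ?_
  rw [blockDiagonal'_mul_apply, mul_apply]
  rfl

variable [∀ i, DecidableEq (m i)]

theorem det_blockDiagonal' (M : (i : o) → Matrix (m i) (m i) R) :
    (blockDiagonal' M).det = ∏ i, (M i).det := by
  let b : (Σ i, m i) → Fin (Fintype.card o) := fun s => Fintype.equivFin o s.1
  have hb : (blockDiagonal' M).BlockTriangular b := fun s t hlt =>
    blockDiagonal'_apply_ne M s.2 t.2 fun hst => hlt.ne (congrArg (Fintype.equivFin o) hst).symm
  rw [hb.det_fintype, ← (Fintype.equivFin o).prod_comp]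
  refine Finset.prod_congr rfl fun i _ => ?_
  let e : m i ≃ {s // b s = Fintype.equivFin o i} := (Equiv.sigmaSubtype i).symm.trans
    (Equiv.subtypeEquivRight fun _ => (Fintype.equivFin o).injective.eq_iff.symm)
  rw [← det_submatrix_equiv_self e]
  congr 1
  ext k l
  exact blockDiagonal'_apply_eq M i k l

theorem inv_blockDiagonal' (M : (i : o) → Matrix (m i) (m i) R) (hM : ∀ i, IsUnit (M i).det) :
    (blockDiagonal' M)⁻¹ = blockDiagonal' fun i => (M i)⁻¹ := by
  refine inv_eq_right_inv ?_
  simp only [← blockDiagonal'_mul, mul_nonsing_inv _ (hM _)]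
  exact blockDiagonal'_one

end BlockDiagonal

theorem transpose_mul_submatrix_symm_mul {m n κ R : Type*} [Fintype m] [Fintype n] [CommRing R]
    (N : Matrix n κ R) (D : Matrix m m R) (e : m ≃ n) :
    Nᵀ * D.submatrix e.symm e.symm * N = (N.submatrix e id)ᵀ * D * N.submatrix e id := by
  have hN : N = (N.submatrix e id).submatrix e.symm id := by
    simp only [submatrix_submatrix, e.self_comp_symm, Function.id_comp, submatrix_id_id]
  conv_lhs => rw [hN, transpose_submatrix, submatrix_mul_equiv, submatrix_mul_equiv,
    submatrix_id_id]

section PullbackMatrix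

variable {U W : Type*} [DecidableEq U]

/-- The matrix of the pullback `x ↦ x ∘ f` of functions along `f : W → U`, which is also the
incidence matrix of `f`. It serves to select coordinates of a vector, possibly with repetitions. -/
def pullbackMatrix (R : Type*) [Zero R] [One R] (f : W → U) : Matrix W U R :=
  (1 : Matrix U U R).submatrix f id

variable (R : Type*) [CommRing R]

theorem pullbackMatrix_apply (f : W → U) (w : W) (u : U) :
    pullbackMatrix R f w u = if f w = u then 1 else 0 := by
  rw [pullbackMatrix, submatrix_apply, id, one_apply]

theorem pullbackMatrix_inr {U' : Type*} [DecidableEq U'] :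
    pullbackMatrix R (Sum.inr : U → U' ⊕ U) = fromCols 0 1 := by
  ext u (u' | u') <;> simp [pullbackMatrix_apply, one_apply]

theorem pullbackMatrix_sumMap_id {U' : Type*} [DecidableEq U'] (f : W → U) :
    pullbackMatrix R (Sum.map (id : U' → U') f) = fromBlocks 1 0 0 (pullbackMatrix R f) := by
  ext (w | w) (u | u) <;> simp [pullbackMatrix_apply, one_apply]

theorem transpose_pullbackMatrix_mul [Fintype W] (f : W → U) :
    (pullbackMatrix R f)ᵀ * pullbackMatrix R f =
      diagonal fun u => ((Finset.univ.filter fun w => f w = u).card : R) := by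
  ext u u'
  simp only [mul_apply, transpose_apply, pullbackMatrix_apply, diagonal_apply, ite_mul, one_mul,
    zero_mul]
  split_ifs with huu'
  · subst huu'
    simp only [Finset.card_filter, Nat.cast_sum, Nat.cast_ite, Nat.cast_one, Nat.cast_zero,
      ← ite_and, and_self]
  · refine Finset.sum_eq_zero fun w _ => ?_
    split_ifs with hwu hwu'
    · exact (huu' (hwu.symm.trans hwu')).elim
    · rfl
    · rfl

variable [Fintype U]

theorem pullbackMatrix_mulVec (f : W → U) (x : U → R) : pullbackMatrix R f *ᵥ x = x ∘ f := by
  ext w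
  simp [mulVec, dotProduct, pullbackMatrix_apply]

theorem pullbackMatrix_mul {κ : Type*} (f : W → U) (M : Matrix U κ R) :
    pullbackMatrix R f * M = M.submatrix f id :=
  one_submatrix_mul f (Equiv.refl U) M

theorem mul_transpose_pullbackMatrix_apply (f : W → U) (w w' : W) :
    (pullbackMatrix R f * (pullbackMatrix R f)ᵀ) w w' = if f w = f w' then 1 else 0 := by
  rw [pullbackMatrix_mul, submatrix_apply, transpose_apply, pullbackMatrix_apply, id]
  exact if_congr eq_comm rfl rfl

end PullbackMatrix

section SigmaBaseMap

variable {V ε : Type*} {m : V → Type*}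

/-- The map `(e, k) ↦ (t e, k)` induced by a map `t : ε → V` of index sets. It sends the
components of the directed edges to those of the vertices. -/
def sigmaBaseMap (m : V → Type*) (t : ε → V) : (Σ e, m (t e)) → Σ i, m i :=
  Sigma.map t fun _ => id

variable [Fintype V] [DecidableEq V] [Fintype ε] [DecidableEq ε] [∀ i, Fintype (m i)]
  [∀ i, DecidableEq (m i)] (t : ε → V)

theorem pullbackMatrix_sigmaBaseMap_mul_blockDiagonal' {R : Type*} [CommRing R]
    (M : (i : V) → Matrix (m i) (m i) R) :
    pullbackMatrix R (sigmaBaseMap m t) * blockDiagonal' M =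
      (blockDiagonal' fun e => M (t e)) * pullbackMatrix R (sigmaBaseMap m t) := by
  rw [pullbackMatrix_mul]
  ext ⟨e, k⟩ ⟨i, l⟩
  rw [blockDiagonal'_mul_apply, submatrix_apply, id, sigmaBaseMap, Sigma.map, id]
  simp only [pullbackMatrix_apply]
  obtain rfl | hne := eq_or_ne (t e) i
  · simp [Sigma.map]
  · simp [Sigma.map, blockDiagonal'_apply_ne _ _ _ hne, hne]

omit [Fintype V] [DecidableEq ε] in
theorem card_filter_sigmaBaseMap_eq (u : Σ i, m i) :
    (Finset.univ.filter fun w => sigmaBaseMap m t w = u).card =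
      (Finset.univ.filter fun e => t e = u.1).card := by
  refine Finset.card_nbij Sigma.fst ?_ ?_ ?_
  · rintro w hw
    simp only [Finset.mem_coe, Finset.mem_filter_univ] at hw ⊢
    exact congrArg Sigma.fst hw
  · rintro ⟨e, k⟩ hk ⟨_, l⟩ hl rfl
    simp only [Finset.mem_coe, Finset.mem_filter_univ] at hk hl
    exact congrArg _ (eq_of_heq (Sigma.mk.inj_iff.1 (hk.trans hl.symm)).2)
  · rintro e he
    obtain ⟨i, l⟩ := u
    obtain rfl : t e = i := by simpa using he
    exact ⟨⟨e, l⟩, Finset.mem_coe.2 (Finset.mem_filter.2 ⟨Finset.mem_univ _, rfl⟩), rfl⟩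

end SigmaBaseMap

theorem fromBlocks_sub {l m n o α : Type*} [AddGroup α] (A : Matrix n l α) (B : Matrix n m α)
    (C : Matrix o l α) (D : Matrix o m α) (A' : Matrix n l α) (B' : Matrix n m α)
    (C' : Matrix o l α) (D' : Matrix o m α) :
    fromBlocks A B C D - fromBlocks A' B' C' D' =
      fromBlocks (A - A') (B - B') (C - C') (D - D') := by
  ext (i | i) (j | j) <;> rfl

section Determinant

variable {F U W R : Type*} [CommRing R] [Fintype F] [DecidableEq F] [Fintype U] [DecidableEq U]
  [Fintype W] [DecidableEq W]

-- Multiplying by `DU` moves `N` past the inverse blocks, after which the determinant is taken in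
-- the other order by `det (1 + XY) = det (1 + YX)`.
theorem det_transpose_mul_inv_mul_add {N : Matrix W U R} {A DW : Matrix W W R}
    {DU S : Matrix U U R} (hA : IsUnit A.det) (hDW : IsUnit DW.det) (hN : N * DU = DW * N)
    (hS : S * DU = 1 - Nᵀ * N) :
    (Nᵀ * A⁻¹ * N + S).det * DU.det * A.det =
      DW.det * (1 - (DW⁻¹ * A - 1) * (N * Nᵀ - 1)).det := by
  have hmul : (Nᵀ * A⁻¹ * N + S) * DU = 1 + Nᵀ * ((A⁻¹ * DW - 1) * N) := by
    rw [Matrix.add_mul, hS, Matrix.mul_assoc _ N DU, hN]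
    simp only [Matrix.sub_mul, Matrix.mul_sub, Matrix.mul_assoc, Matrix.one_mul]
    abel
  have hfactor : A * (1 + (A⁻¹ * DW - 1) * N * Nᵀ) =
      DW * (1 - (DW⁻¹ * A - 1) * (N * Nᵀ - 1)) := by
    simp only [Matrix.mul_add, Matrix.mul_sub, Matrix.sub_mul, Matrix.mul_one, Matrix.one_mul,
      Matrix.mul_assoc, mul_nonsing_inv_cancel_left _ _ hA, mul_nonsing_inv_cancel_left _ _ hDW]
    abel
  rw [← det_mul, hmul, det_one_add_mul_comm, mul_comm, ← det_mul, hfactor, det_mul]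

theorem det_one_sub_mul_fromBlocks_zero (M : Matrix (F ⊕ W) (F ⊕ W) R) (T : Matrix W W R) :
    (1 - M * fromBlocks 0 0 0 T).det = (1 - M.toBlocks₂₂ * T).det := by
  have hblocks : 1 - M * fromBlocks 0 0 0 T =
      fromBlocks 1 (-(M.toBlocks₁₂ * T)) 0 (1 - M.toBlocks₂₂ * T) := by
    conv_lhs => rw [← fromBlocks_toBlocks M, fromBlocks_multiply, ← fromBlocks_one, fromBlocks_sub]
    simp
  rw [hblocks, det_fromBlocks_zero₂₁, det_one, one_mul]

theorem det_fromBlocks_transpose_mul_inv_mul_add {N : Matrix W U R}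
    {A : Matrix (F ⊕ W) (F ⊕ W) R} {DW : Matrix W W R} {DU S : Matrix U U R}
    (hA : IsUnit A.det) (hDW : IsUnit DW.det) (hN : N * DU = DW * N)
    (hS : S * DU = 1 - Nᵀ * N) :
    ((fromBlocks (1 : Matrix F F R) 0 0 N)ᵀ * A⁻¹ * fromBlocks (1 : Matrix F F R) 0 0 N +
        fromBlocks 0 0 0 S).det * DU.det * A.det =
      DW.det * (1 - (DW⁻¹ * A.toBlocks₂₂ - 1) * (N * Nᵀ - 1)).det := by
  have hinv : (fromBlocks (1 : Matrix F F R) 0 0 DW)⁻¹ = fromBlocks 1 0 0 DW⁻¹ :=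
    inv_eq_right_inv (by simp [fromBlocks_multiply, mul_nonsing_inv _ hDW])
  have hadj : fromBlocks (1 : Matrix F F R) 0 0 N * (fromBlocks (1 : Matrix F F R) 0 0 N)ᵀ - 1 =
      fromBlocks 0 0 0 (N * Nᵀ - 1) := by
    rw [fromBlocks_transpose, fromBlocks_multiply, ← fromBlocks_one, fromBlocks_sub]
    simp
  have hcorner : (fromBlocks (1 : Matrix F F R) 0 0 DW⁻¹ * A - 1).toBlocks₂₂ =
      DW⁻¹ * A.toBlocks₂₂ - 1 := by
    conv_lhs => rw [← fromBlocks_toBlocks A, fromBlocks_multiply, ← fromBlocks_one, fromBlocks_sub]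
    simp
  have key := det_transpose_mul_inv_mul_add (N := fromBlocks (1 : Matrix F F R) 0 0 N) (A := A)
    (DW := fromBlocks 1 0 0 DW) (DU := fromBlocks 1 0 0 DU) (S := fromBlocks 0 0 0 S) hA
    (by simpa using hDW) (by simp [fromBlocks_multiply, hN]) (by
      rw [fromBlocks_transpose, fromBlocks_multiply, fromBlocks_multiply, ← fromBlocks_one,
        fromBlocks_sub]
      simp [hS])
  simpa only [hinv, hadj, det_one_sub_mul_fromBlocks_zero, hcorner, det_fromBlocks_zero₂₁, det_one,
    one_mul] using key

end Determinant

theorem prod_pow_mul_prod_zpow_one_sub {ι K : Type*} [Fintype ι] [Field K] {a : ι → K}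
    (ha : ∀ i, a i ≠ 0) (d : ι → ℕ) :
    (∏ i, a i ^ d i) * ∏ i, a i ^ (1 - (d i : ℤ)) = ∏ i, a i := by
  rw [← Finset.prod_mul_distrib]
  refine Finset.prod_congr rfl fun i _ => ?_
  rw [← zpow_natCast, ← zpow_add₀ (ha i), add_sub_cancel, zpow_one]

/-! ### Calculus of Hessians -/

section Hessian

variable {κ : Type*} [Fintype κ] [DecidableEq κ] {f g : (κ → ℝ) → ℝ} {x : κ → ℝ}

theorem differentiableAt_fderiv_of_contDiffAt_two {E F : Type*} [NormedAddCommGroup E]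
    [NormedSpace ℝ E] [NormedAddCommGroup F] [NormedSpace ℝ F] {f : E → F} {x : E}
    (hf : ContDiffAt ℝ 2 f x) : DifferentiableAt ℝ (fderiv ℝ f) x :=
  (hf.fderiv_right (m := 1) (by norm_num)).differentiableAt one_ne_zero

theorem hessian_add (hf : ContDiffAt ℝ 2 f x) (hg : ContDiffAt ℝ 2 g x) :
    hessian (fun y => f y + g y) x = hessian f x + hessian g x := by
  have hfderiv : fderiv ℝ (fun y => f y + g y) =ᶠ[𝓝 x] fun y => fderiv ℝ f y + fderiv ℝ g y := by
    filter_upwards [hf.eventually (by simp), hg.eventually (by simp)] with y hfy hgy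
    exact fderiv_fun_add (hfy.differentiableAt two_ne_zero) (hgy.differentiableAt two_ne_zero)
  ext a b
  rw [hessian, of_apply, hfderiv.fderiv_eq,
    fderiv_fun_add (differentiableAt_fderiv_of_contDiffAt_two hf)
      (differentiableAt_fderiv_of_contDiffAt_two hg)]
  rfl

theorem hessian_const_mul (c : ℝ) (hf : ContDiffAt ℝ 2 f x) :
    hessian (fun y => c * f y) x = c • hessian f x := by
  have hfderiv : fderiv ℝ (fun y => c * f y) =ᶠ[𝓝 x] fun y => c • fderiv ℝ f y := by
    filter_upwards [hf.eventually (by simp)] with y hfy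
    exact fderiv_const_mul (hfy.differentiableAt two_ne_zero) c
  ext a b
  rw [hessian, of_apply, hfderiv.fderiv_eq,
    fderiv_fun_const_smul (differentiableAt_fderiv_of_contDiffAt_two hf) c]
  rfl

theorem hessian_continuousLinearMap (φ : (κ → ℝ) →L[ℝ] ℝ) (x : κ → ℝ) : hessian φ x = 0 := by
  have hfderiv : fderiv ℝ φ = fun _ => φ := funext fun _ => φ.fderiv
  ext a b
  simp [hessian, hfderiv]

theorem hessian_sum {ι : Type*} (s : Finset ι) {f : ι → (κ → ℝ) → ℝ}
    (hf : ∀ i ∈ s, ContDiffAt ℝ 2 (f i) x) :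
    hessian (fun y => ∑ i ∈ s, f i y) x = ∑ i ∈ s, hessian (f i) x := by
  classical
  induction s using Finset.induction with
  | empty => exact hessian_continuousLinearMap 0 x
  | insert i s hi ih =>
    simp only [Finset.sum_insert hi]
    rw [hessian_add (hf i (Finset.mem_insert_self i s))
      (ContDiffAt.sum fun j hj => hf j (Finset.mem_insert_of_mem hj)),
      ih fun j hj => hf j (Finset.mem_insert_of_mem hj)]

theorem fderiv_fderiv_comp_continuousLinearMap {E F G : Type*} [NormedAddCommGroup E]
    [NormedSpace ℝ E] [NormedAddCommGroup F] [NormedSpace ℝ F] [NormedAddCommGroup G]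
    [NormedSpace ℝ G] (P : E →L[ℝ] F) {f : F → G} {x : E} (hf : ContDiffAt ℝ 2 f (P x)) (v w : E) :
    fderiv ℝ (fderiv ℝ fun y => f (P y)) x v w = fderiv ℝ (fderiv ℝ f) (P x) (P v) (P w) := by
  have hfderiv : fderiv ℝ (fun y => f (P y)) =ᶠ[𝓝 x] fun y => P.precomp G (fderiv ℝ f (P y)) := by
    filter_upwards [P.continuous.continuousAt.eventually (hf.eventually (by simp))] with y hy
    exact ((hy.differentiableAt two_ne_zero).hasFDerivAt.comp y P.hasFDerivAt).fderiv
  have hf' := (differentiableAt_fderiv_of_contDiffAt_two hf).hasFDerivAt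
  have hcomp : HasFDerivAt (fun y => P.precomp G (fderiv ℝ f (P y))) _ x :=
    (P.precomp G).hasFDerivAt.comp x (hf'.comp x P.hasFDerivAt)
  rw [hfderiv.fderiv_eq, hcomp.fderiv]
  rfl

theorem hessian_comp_mulVec {l : Type*} [Fintype l] [DecidableEq l] (P : Matrix l κ ℝ)
    {f : (l → ℝ) → ℝ} (hf : ContDiffAt ℝ 2 f (P *ᵥ x)) :
    hessian (fun y => f (P *ᵥ y)) x = Pᵀ * hessian f (P *ᵥ x) * P := by
  have hcomp := LinearMap.toMatrix₂'_compl₁₂ (R := ℝ)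
    (fderiv ℝ (fderiv ℝ f) (P *ᵥ x)).toLinearMap₁₂ (toLin' P) (toLin' P)
  rw [LinearMap.toMatrix'_toLin'] at hcomp
  refine Eq.trans ?_ hcomp
  ext a b
  exact fderiv_fderiv_comp_continuousLinearMap ((toLin' P).toContinuousLinearMap) hf
    (Pi.single a 1) (Pi.single b 1)

section Select

variable {ι : Type*} [Fintype ι] [DecidableEq ι] {l : ι → Type*} [∀ i, Fintype (l i)]
  [∀ i, DecidableEq (l i)]

omit [DecidableEq κ] in
theorem contDiffAt_comp_select {l : Type*} [Fintype l] (σ : l → κ) {f : (l → ℝ) → ℝ}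
    (hf : ContDiffAt ℝ 2 f (x ∘ σ)) : ContDiffAt ℝ 2 (fun y => f (y ∘ σ)) x :=
  hf.comp x (contDiff_pi.2 fun k => contDiff_apply ℝ ℝ (σ k)).contDiffAt

theorem hessian_sum_comp {f : ∀ i, (l i → ℝ) → ℝ} (σ : ∀ i, l i → κ)
    (hf : ∀ i, ContDiffAt ℝ 2 (f i) (x ∘ σ i)) :
    hessian (fun y => ∑ i, f i (y ∘ σ i)) x =
      (pullbackMatrix ℝ fun s : Σ i, l i => σ s.1 s.2)ᵀ *
        blockDiagonal' (fun i => hessian (f i) (x ∘ σ i)) *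
        pullbackMatrix ℝ fun s : Σ i, l i => σ s.1 s.2 := by
  rw [hessian_sum _ fun i _ => contDiffAt_comp_select (σ i) (hf i),
    transpose_mul_blockDiagonal'_mul]
  refine Finset.sum_congr rfl fun i _ => ?_
  have hfi := hf i
  simp only [← pullbackMatrix_mulVec] at hfi ⊢
  exact hessian_comp_mulVec _ hfi

end Select

end Hessian

/-! ### The edge matrix of weights induced by the factors -/

namespace FinHypergraph

variable {V : Type*} [DecidableEq V] {H : FinHypergraph V}

theorem card_filter_tgt_eq (i : V) :
    (Finset.univ.filter fun e : H.DirEdge => tgt e = i).card = H.degree i := by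
  refine Finset.card_bij (fun e _ => (src e).1) ?_ ?_ ?_
  · rintro ⟨α, j, hj⟩ h
    obtain rfl : j = i := (Finset.mem_filter.1 h).2
    exact Finset.mem_filter.2 ⟨α.2, hj⟩
  · rintro ⟨⟨α, hα⟩, j, hj⟩ h ⟨⟨β, hβ⟩, j', hj'⟩ h' rfl
    obtain rfl : j = i := (Finset.mem_filter.1 h).2
    obtain rfl : j' = j := (Finset.mem_filter.1 h').2
    rfl
  · intro α hα
    obtain ⟨hαH, hi⟩ := Finset.mem_filter.1 hα
    exact ⟨⟨⟨α, hαH⟩, i, hi⟩, Finset.mem_filter.2 ⟨Finset.mem_univ _, rfl⟩, rfl⟩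

/-- The incidence matrix of the directed edges and their termini, with `r i` components at the
vertex `i`. It expresses `M(u)` and the Hessian of the Bethe free energy. -/
noncomputable def incidence (H : FinHypergraph V) (r : V → ℕ) (R : Type*) [Zero R] [One R] :
    Matrix (Σ e : H.DirEdge, Fin (r (tgt e))) (Σ i, Fin (r i)) R :=
  pullbackMatrix R (sigmaBaseMap (fun i => Fin (r i)) tgt)

theorem transpose_incidence_mul_incidence (r : V → ℕ) (R : Type*) [CommRing R] :
    (H.incidence r R)ᵀ * H.incidence r R = diagonal fun u => (H.degree u.1 : R) := by
  rw [incidence, transpose_pullbackMatrix_mul]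
  congr 1
  funext u
  rw [← card_filter_tgt_eq]
  exact congrArg _ (card_filter_sigmaBaseMap_eq tgt u)

section LocalMatrix

variable {r : V → ℕ} {R : Type*}

/-- The matrix of the operator that carries `f (α → i)` to the edges `α → j`, `j ≠ i`, of the same
factor by means of `u^α_{i → j}`. In contrast to `M(u)`, all its transitions stay in one factor. -/
def localMatrix [Zero R] (u : (α : H.Factor) → (i j : {i : V // i ∈ α.1}) →
    Matrix (Fin (r j)) (Fin (r i)) R) :
    Matrix (Σ e : H.DirEdge, Fin (r (tgt e))) (Σ e : H.DirEdge, Fin (r (tgt e))) R :=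
  of fun w w' => if h : src w'.1 = src w.1 ∧ tgt w'.1 ≠ tgt w.1 then
    u (src w.1) ⟨tgt w'.1, h.1 ▸ w'.1.2.2⟩ w.1.2 w.2 w'.2 else 0

section Apply

variable [Zero R] (u : (α : H.Factor) → (i j : {i : V // i ∈ α.1}) →
  Matrix (Fin (r j)) (Fin (r i)) R)

theorem localMatrix_apply_of_src_ne {w w' : Σ e : H.DirEdge, Fin (r (tgt e))}
    (h : src w'.1 ≠ src w.1) : localMatrix u w w' = 0 :=
  dif_neg fun h' => h h'.1

theorem localMatrix_apply_self (e : H.DirEdge) (k l : Fin (r (tgt e))) :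
    localMatrix u ⟨e, k⟩ ⟨e, l⟩ = 0 :=
  dif_neg fun h => h.2 rfl

theorem localMatrix_apply_of_ne (α : H.Factor) {i j : {i : V // i ∈ α.1}} (h : j ≠ i)
    (k : Fin (r i)) (l : Fin (r j)) :
    localMatrix u ⟨⟨α, i⟩, k⟩ ⟨⟨α, j⟩, l⟩ = u α j i k l :=
  dif_pos ⟨rfl, fun h' => h (Subtype.ext h')⟩

theorem localMatrix_map {S : Type*} [Zero S] (f : R → S) (hf : f 0 = 0) :
    localMatrix (fun α i j => (u α i j).map f) = (localMatrix u).map f := by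
  ext w w'
  simp only [localMatrix, of_apply, map_apply, apply_dite f, hf]

end Apply

variable [Fintype V] [CommRing R] (u : (α : H.Factor) → (i j : {i : V // i ∈ α.1}) →
  Matrix (Fin (r j)) (Fin (r i)) R)

theorem incidence_mul_transpose_apply (e e' : H.DirEdge) (k : Fin (r (tgt e)))
    (l : Fin (r (tgt e'))) :
    (H.incidence r R * (H.incidence r R)ᵀ) ⟨e, k⟩ ⟨e', l⟩ =
      if (⟨tgt e, k⟩ : Σ i, Fin (r i)) = ⟨tgt e', l⟩ then 1 else 0 :=
  mul_transpose_pullbackMatrix_apply R _ _ _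

theorem exists_eq_of_localMatrix_mul_incidence_ne_zero {α β : H.Factor} {i : {i : V // i ∈ α.1}}
    {j : {i : V // i ∈ β.1}} {k : Fin (r i)} {l : Fin (r j)} {v : Σ e : H.DirEdge, Fin (r (tgt e))}
    (hv : localMatrix u ⟨⟨α, i⟩, k⟩ v *
      (H.incidence r R * (H.incidence r R)ᵀ) v ⟨⟨β, j⟩, l⟩ ≠ 0) :
    ∃ h : j.1 ∈ α.1, j.1 ≠ i.1 ∧ v = ⟨⟨α, ⟨j, h⟩⟩, l⟩ := by
  obtain ⟨⟨γ, j', hj'⟩, l'⟩ := v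
  obtain rfl : γ = α := by
    by_contra h
    exact hv (by rw [localMatrix_apply_of_src_ne u h, zero_mul])
  have htgt : (⟨j', l'⟩ : Σ i, Fin (r i)) = ⟨j, l⟩ := by
    by_contra h
    exact hv (by rw [incidence_mul_transpose_apply, if_neg h, mul_zero])
  obtain ⟨rfl, hl⟩ := Sigma.mk.inj_iff.1 htgt
  obtain rfl := eq_of_heq hl
  refine ⟨hj', fun h => ?_, rfl⟩
  obtain rfl : i = ⟨j.1, hj'⟩ := Subtype.ext h.symm
  exact hv (by rw [localMatrix_apply_self, zero_mul])

theorem localMatrix_mul_incidence_mul_transpose_apply (α β : H.Factor) (i : {i : V // i ∈ α.1})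
    (j : {i : V // i ∈ β.1}) (k : Fin (r i)) (l : Fin (r j)) :
    (localMatrix u * (H.incidence r R * (H.incidence r R)ᵀ)) ⟨⟨α, i⟩, k⟩ ⟨⟨β, j⟩, l⟩ =
      if h : j.1 ∈ α.1 ∧ j.1 ≠ i.1 then u α ⟨j, h.1⟩ i k l else 0 := by
  rw [mul_apply]
  split_ifs with h
  · rw [Finset.sum_eq_single ⟨⟨α, ⟨j, h.1⟩⟩, l⟩, incidence_mul_transpose_apply, if_pos rfl,
      mul_one, localMatrix_apply_of_ne _ _ fun h' => h.2 (congrArg Subtype.val h')]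
    · intro v _ hne
      by_contra hv
      exact hne (exists_eq_of_localMatrix_mul_incidence_ne_zero u hv).2.2
    · exact fun h => (h (Finset.mem_univ _)).elim
  · refine Finset.sum_eq_zero fun v _ => ?_
    by_contra hv
    obtain ⟨hj, hne, -⟩ := exists_eq_of_localMatrix_mul_incidence_ne_zero u hv
    exact h ⟨hj, hne⟩

-- `N Nᵀ - 1` moves from `α → i` to all the edges `β → i` with `β ≠ α`: subtracting `1` forbids
-- backtracking.
theorem edgeMatrix_weightOfFactors (u : (α : H.Factor) → (i j : {i : V // i ∈ α.1}) →
    Matrix (Fin (r j)) (Fin (r i)) ℂ) :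
    (H.weightOfFactors r u).edgeMatrix =
      localMatrix u * (H.incidence r ℂ * (H.incidence r ℂ)ᵀ - 1) := by
  ext ⟨⟨α, i⟩, k⟩ ⟨⟨β, j⟩, l⟩
  rw [mul_sub, mul_one, Matrix.sub_apply, localMatrix_mul_incidence_mul_transpose_apply]
  change (H.weightOfFactors r u).block ⟨α, i⟩ ⟨β, j⟩ k l = _
  obtain rfl | hβα := eq_or_ne β α
  · rw [Weight.block, dif_neg fun h => h.2.2 rfl]
    obtain rfl | hji := eq_or_ne j i
    · rw [localMatrix_apply_self, dif_neg fun h => h.2 rfl, sub_zero]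
      rfl
    · rw [localMatrix_apply_of_ne _ _ hji, dif_pos ⟨j.2, fun h => hji (Subtype.ext h)⟩, sub_self]
      rfl
  · rw [localMatrix_apply_of_src_ne _ hβα, sub_zero, Weight.block]
    by_cases h : j.1 ∈ α.1 ∧ j.1 ≠ i.1
    · rw [dif_pos h, dif_pos ⟨h.1, h.2, hβα⟩]
      rfl
    · rw [dif_neg h, dif_neg fun h' => h ⟨h'.1, h'.2.1⟩]
      rfl

end LocalMatrix

end FinHypergraph

/-! ### Beliefs -/

namespace ExpFamily

variable {X : Type*} [MeasurableSpace X] {ι : Type*} [Fintype ι] {E : ExpFamily X ι}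

theorem exists_belief_eq_law {η : ι → ℝ} (hη : η ∈ E.meanSet) :
    ∃ θ ∈ E.paramSet, E.meanMap θ = η ∧ E.belief η = E.law θ :=
  ⟨_, Function.invFunOn_mem hη, Function.invFunOn_eq hη, rfl⟩

variable [DecidableEq ι] (hφ : Measurable E.stat) (hν : E.base ≠ 0)
  (hH : ∀ θ ∈ E.paramSet, IsUnit (hessian E.logPartition θ)) {η θ : ι → ℝ}

include hφ hν hH

theorem isUnit_varMatrix_law (hθ : θ ∈ E.paramSet) : IsUnit (varMatrix (E.law θ) E.stat) :=
  hessian_logPartition hφ hν hθ ▸ hH θ hθ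

theorem belief_meanMap (hθ : θ ∈ E.paramSet) : E.belief (E.meanMap θ) = E.law θ :=
  congrArg E.law <| (meanMap_injOn hφ hν fun _ =>
    isUnit_varMatrix_law hφ hν hH).leftInvOn_invFunOn hθ

theorem isUnit_varMatrix_belief (hη : η ∈ E.meanSet) :
    IsUnit (varMatrix (E.belief η) E.stat) := by
  obtain ⟨θ, hθ, -, hbelief⟩ := exists_belief_eq_law hη
  exact hbelief ▸ isUnit_varMatrix_law hφ hν hH hθ

theorem contDiffAt_legendre_of_mem_meanSet (hη : η ∈ E.meanSet) :
    ContDiffAt ℝ 2 E.legendre η := by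
  obtain ⟨θ, hθ, rfl⟩ := hη
  exact contDiffAt_legendre hφ hν hθ (isUnit_varMatrix_law hφ hν hH hθ)

theorem hessian_legendre_of_mem_meanSet (hη : η ∈ E.meanSet) :
    hessian E.legendre η = (varMatrix (E.belief η) E.stat)⁻¹ := by
  obtain ⟨θ, hθ, rfl⟩ := hη
  rw [hessian_legendre hφ hν hθ (isUnit_varMatrix_law hφ hν hH hθ), belief_meanMap hφ hν hH hθ]

end ExpFamily

namespace InferenceFamily

variable {V : Type*} [DecidableEq V] {H : FinHypergraph V} {X : V → Type*}
  [∀ i, MeasurableSpace (X i)] {I : InferenceFamily H X}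

theorem measurable_factorFamily_stat (α : H.Factor) : Measurable (I.factorFamily α).stat := by
  refine measurable_pi_iff.2 ?_
  rintro (k | k)
  · exact (measurable_pi_apply k).comp (I.measurable_statF α)
  · exact (measurable_pi_apply k.2).comp ((I.measurable_statV k.1).comp (measurable_pi_apply k.1))

theorem factorFamily_base_ne_zero (α : H.Factor) : (I.factorFamily α).base ≠ 0 := by
  have := I.sigmaFinite_base
  refine fun h => absurd (Measure.measure_univ_eq_zero.2 h) ?_
  change Measure.pi (fun i : {i : V // i ∈ α.1} => I.base i) Set.univ ≠ 0
  rw [Measure.pi_univ]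
  exact Finset.prod_ne_zero_iff.2 fun i _ => (Measure.measure_univ_ne_zero).2 (I.base_ne_zero i)

variable {η : I.Coord → ℝ} (hη : η ∈ I.localSet)

include hη

theorem isUnit_det_vertexVar (i : V) : IsUnit (I.vertexVar η i).det :=
  (isUnit_iff_isUnit_det _).1 <| ExpFamily.isUnit_varMatrix_belief (I.measurable_statV i)
    (I.base_ne_zero i) (I.hessian_vertex_invertible i) (hη.2 i)

theorem isUnit_det_factorVar (α : H.Factor) : IsUnit (I.factorVar η α).det :=
  (isUnit_iff_isUnit_det _).1 <| ExpFamily.isUnit_varMatrix_belief (measurable_factorFamily_stat α)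
    (factorFamily_base_ne_zero α) (I.hessian_factor_invertible α) (hη.1 α)

theorem contDiffAt_legendre_vertexPart (i : V) :
    ContDiffAt ℝ 2 (I.vertexFamily i).legendre (I.vertexPart η i) :=
  ExpFamily.contDiffAt_legendre_of_mem_meanSet (I.measurable_statV i) (I.base_ne_zero i)
    (I.hessian_vertex_invertible i) (hη.2 i)

theorem contDiffAt_legendre_factorPart (α : H.Factor) :
    ContDiffAt ℝ 2 (I.factorFamily α).legendre (I.factorPart η α) :=
  ExpFamily.contDiffAt_legendre_of_mem_meanSet (measurable_factorFamily_stat α)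
    (factorFamily_base_ne_zero α) (I.hessian_factor_invertible α) (hη.1 α)

theorem hessian_legendre_vertexPart (i : V) :
    hessian (I.vertexFamily i).legendre (I.vertexPart η i) = (I.vertexVar η i)⁻¹ :=
  ExpFamily.hessian_legendre_of_mem_meanSet (I.measurable_statV i) (I.base_ne_zero i)
    (I.hessian_vertex_invertible i) (hη.2 i)

theorem hessian_legendre_factorPart (α : H.Factor) :
    hessian (I.factorFamily α).legendre (I.factorPart η α) = (I.factorVar η α)⁻¹ :=
  ExpFamily.hessian_legendre_of_mem_meanSet (measurable_factorFamily_stat α)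
    (factorFamily_base_ne_zero α) (I.hessian_factor_invertible α) (hη.1 α)

theorem map_factorBelief (α : H.Factor) (i : {i : V // i ∈ α.1}) :
    (I.factorBelief η α).map (fun x => x i) = I.vertexBelief η i := by
  obtain ⟨θ, hθ, hmean, hbelief⟩ := ExpFamily.exists_belief_eq_law (hη.1 α)
  obtain ⟨θ', hθ', hlaw⟩ := I.marginally_closed α i θ hθ
  have hmean' : (I.vertexFamily i).meanMap θ' = I.vertexPart η i := by
    funext k
    rw [ExpFamily.meanMap, ← hlaw, integral_map (measurable_pi_apply i).aemeasurable]
    · exact congrFun hmean (Sum.inr ⟨i, k⟩)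
    · exact ((measurable_pi_apply k).comp (I.measurable_statV i)).aestronglyMeasurable
  rw [factorBelief, hbelief, hlaw, vertexBelief, ← hmean']
  exact (ExpFamily.belief_meanMap (I.measurable_statV i) (I.base_ne_zero i)
    (I.hessian_vertex_invertible i) hθ').symm

theorem covMatrix_factorBelief_self (α : H.Factor) (i : {i : V // i ∈ α.1}) :
    covMatrix (I.factorBelief η α) (fun x => I.statV i (x i)) (fun x => I.statV i (x i)) =
      I.vertexVar η i := by
  have hstat (k : Fin (I.dimV i)) : Measurable fun y => I.statV i y k :=
    (measurable_pi_apply k).comp (I.measurable_statV i)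
  ext k l
  rw [vertexVar, ← map_factorBelief hη α i, varMatrix, covMatrix, covMatrix, of_apply, of_apply,
    covariance_map_fun (hstat k).aestronglyMeasurable (hstat l).aestronglyMeasurable
      (measurable_pi_apply i).aemeasurable]

omit hη

/-! ### The Hessian of the Bethe free energy -/

/-- The splitting of the components of all the `φ_α` into those of the `φ_⟨α⟩` and those of the
vertex statistics, the latter being indexed by the directed edges `α → i`. -/
def factorIdxEquiv (I : InferenceFamily H X) : (Σ α : H.Factor, I.FactorIdx α) ≃
    (Σ α : H.Factor, Fin (I.dimF α)) ⊕ (Σ e : H.DirEdge, Fin (I.edgeDim e)) :=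
  (Equiv.sigmaSumDistrib _ _).trans (Equiv.sumCongr (Equiv.refl _) (Equiv.sigmaAssoc
    fun (α : H.Factor) (i : {i : V // i ∈ α.1}) => Fin (I.dimV i)).symm)

/-- The block diagonal matrix of the `Var_{b_α}(φ_α)`, the blocks of the Legendre transforms in
the Hessian of the Bethe free energy being its inverse. -/
noncomputable def allFactorVar (I : InferenceFamily H X) (η : I.Coord → ℝ) :
    Matrix ((Σ α : H.Factor, Fin (I.dimF α)) ⊕ (Σ e : H.DirEdge, Fin (I.edgeDim e)))
      ((Σ α : H.Factor, Fin (I.dimF α)) ⊕ (Σ e : H.DirEdge, Fin (I.edgeDim e))) ℝ :=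
  reindex I.factorIdxEquiv I.factorIdxEquiv (blockDiagonal' (I.factorVar η))

/-- The block diagonal matrix that has the block `Var_{b_i}(φ_i)` at each directed edge
`α → i`. -/
noncomputable def edgeVar (I : InferenceFamily H X) (η : I.Coord → ℝ) :
    Matrix (Σ e : H.DirEdge, Fin (I.edgeDim e)) (Σ e : H.DirEdge, Fin (I.edgeDim e)) ℝ :=
  blockDiagonal' fun e : H.DirEdge => I.vertexVar η (FinHypergraph.tgt e)

/-- The incidence matrix of the components of all the `φ_α` and the coordinates of `η`. -/
noncomputable def coordIncidence (I : InferenceFamily H X) :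
    Matrix ((Σ α : H.Factor, Fin (I.dimF α)) ⊕ (Σ e : H.DirEdge, Fin (I.edgeDim e))) I.Coord ℝ :=
  fromBlocks 1 0 0 (H.incidence I.dimV ℝ)

/-- The coordinates that make up `η_α`. -/
def factorCoord (I : InferenceFamily H X) (α : H.Factor) : I.FactorIdx α → I.Coord :=
  Sum.elim (fun k => .inl ⟨α, k⟩) fun k => .inr ⟨k.1, k.2⟩

theorem factorPart_eq_comp (η : I.Coord → ℝ) (α : H.Factor) :
    I.factorPart η α = η ∘ I.factorCoord α := by
  ext (k | k) <;> rfl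

theorem factorCoord_eq_sumMap_comp : (fun s : Σ α, I.FactorIdx α => I.factorCoord s.1 s.2) =
    Sum.map id (sigmaBaseMap (fun i => Fin (I.dimV i)) FinHypergraph.tgt) ∘ I.factorIdxEquiv := by
  ext ⟨α, k | k⟩ <;> rfl

variable (θbar : (α : H.Factor) → I.FactorIdx α → ℝ)

include hη

theorem contDiffAt_factorTerm (α : H.Factor) :
    ContDiffAt ℝ 2 (fun ξ => dotCLM _ (-θbar α) ξ + (I.factorFamily α).legendre ξ)
      (η ∘ I.factorCoord α) :=
  (dotCLM _ _).contDiff.contDiffAt.add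
    (factorPart_eq_comp η α ▸ contDiffAt_legendre_factorPart hη α)

theorem contDiffAt_vertexTerm (i : V) :
    ContDiffAt ℝ 2 (fun ξ => (1 - (H.degree i : ℝ)) * (I.vertexFamily i).legendre ξ)
      (I.vertexPart η i) :=
  contDiffAt_const.mul (contDiffAt_legendre_vertexPart hη i)

theorem hessian_factorTerm (α : H.Factor) :
    hessian (fun ξ => dotCLM _ (-θbar α) ξ + (I.factorFamily α).legendre ξ)
      (η ∘ I.factorCoord α) = (I.factorVar η α)⁻¹ := by
  rw [← factorPart_eq_comp, hessian_add (dotCLM _ _).contDiff.contDiffAt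
    (contDiffAt_legendre_factorPart hη α), hessian_continuousLinearMap, zero_add,
    hessian_legendre_factorPart hη α]

theorem hessian_vertexTerm (i : V) :
    hessian (fun ξ => (1 - (H.degree i : ℝ)) * (I.vertexFamily i).legendre ξ)
      (I.vertexPart η i) = (1 - (H.degree i : ℝ)) • (I.vertexVar η i)⁻¹ := by
  rw [hessian_const_mul _ (contDiffAt_legendre_vertexPart hη i), hessian_legendre_vertexPart hη i]

theorem inv_allFactorVar : (I.allFactorVar η)⁻¹ =
    (blockDiagonal' fun α => (I.factorVar η α)⁻¹).submatrix I.factorIdxEquiv.symm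
      I.factorIdxEquiv.symm := by
  rw [allFactorVar, reindex_apply, inv_submatrix_equiv,
    inv_blockDiagonal' _ fun α => isUnit_det_factorVar hη α]

theorem isUnit_det_allFactorVar : IsUnit (I.allFactorVar η).det := by
  rw [allFactorVar, det_reindex_self, det_blockDiagonal']
  exact IsUnit.prod_univ_iff.2 fun α => isUnit_det_factorVar hη α

theorem isUnit_det_edgeVar : IsUnit (I.edgeVar η).det := by
  rw [edgeVar, det_blockDiagonal']
  exact IsUnit.prod_univ_iff.2 fun e => isUnit_det_vertexVar hη _

theorem edgeVar_inv_mul_toBlocks₂₂_sub_one :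
    (I.edgeVar η)⁻¹ * (I.allFactorVar η).toBlocks₂₂ - 1 =
      FinHypergraph.localMatrix (I.factorWeight η) := by
  rw [edgeVar, inv_blockDiagonal' _ fun e => isUnit_det_vertexVar hη _]
  ext ⟨⟨α, i⟩, k⟩ ⟨⟨β, j⟩, l⟩
  have hentry (m : Fin (I.dimV i)) : (I.allFactorVar η).toBlocks₂₂ ⟨⟨α, i⟩, m⟩ ⟨⟨β, j⟩, l⟩ =
    blockDiagonal' (I.factorVar η) ⟨α, .inr ⟨i, m⟩⟩ ⟨β, .inr ⟨j, l⟩⟩ := rfl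
  rw [Matrix.sub_apply, blockDiagonal'_mul_apply]
  simp only [hentry]
  obtain rfl | hβα := eq_or_ne β α
  · simp only [blockDiagonal'_apply_eq]
    change ((I.vertexVar η i)⁻¹ * covMatrix (I.factorBelief η β) (fun x => I.statV i (x i))
      (fun x => I.statV j (x j))) k l - _ = _
    obtain rfl | hji := eq_or_ne j i
    · rw [covMatrix_factorBelief_self hη, nonsing_inv_mul _ (isUnit_det_vertexVar hη _),
        FinHypergraph.localMatrix_apply_self]
      simp [one_apply]
    · rw [FinHypergraph.localMatrix_apply_of_ne _ _ hji, one_apply_ne, sub_zero, factorWeight]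
      simp [hji.symm]
  · rw [FinHypergraph.localMatrix_apply_of_src_ne _ hβα, one_apply_ne, sub_zero]
    · simp only [blockDiagonal'_apply_ne _ _ _ hβα.symm, mul_zero, Finset.sum_const_zero]
    · simp [hβα.symm]

omit hη

variable [Fintype V]

theorem betheFreeEnergy_eq : I.betheFreeEnergy θbar = fun y =>
    ∑ α : H.Factor, (fun ξ => dotCLM _ (-θbar α) ξ + (I.factorFamily α).legendre ξ)
      (y ∘ I.factorCoord α) +
    ∑ i : V, (fun ξ => (1 - (H.degree i : ℝ)) * (I.vertexFamily i).legendre ξ)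
      (y ∘ fun k => .inr ⟨i, k⟩) := by
  funext y
  simp only [betheFreeEnergy, factorPart_eq_comp, dotCLM_apply, neg_dotProduct,
    Finset.sum_add_distrib, Finset.sum_neg_distrib]
  rfl

include hη

theorem contDiffAt_betheFreeEnergy : ContDiffAt ℝ 2 (I.betheFreeEnergy θbar) η := by
  rw [betheFreeEnergy_eq]
  exact (ContDiffAt.sum fun α _ => contDiffAt_comp_select _ (contDiffAt_factorTerm hη θbar α)).add
    (ContDiffAt.sum fun i _ => contDiffAt_comp_select _ (contDiffAt_vertexTerm hη i))

theorem edgeMatrix_weight : (I.weight η).edgeMatrix =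
    (((I.edgeVar η)⁻¹ * (I.allFactorVar η).toBlocks₂₂ - 1) *
      (H.incidence I.dimV ℝ * (H.incidence I.dimV ℝ)ᵀ - 1)).map Complex.ofReal := by
  rw [edgeVar_inv_mul_toBlocks₂₂_sub_one hη]
  have hincidence : H.incidence I.dimV ℂ = (H.incidence I.dimV ℝ).map Complex.ofRealHom := by
    ext w v
    simp [FinHypergraph.incidence, pullbackMatrix_apply, apply_ite]
  change _ = Complex.ofRealHom.mapMatrix (_ * _)
  rw [map_mul, map_sub, map_one, RingHom.mapMatrix_apply, RingHom.mapMatrix_apply, Matrix.map_mul,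
    transpose_map, ← hincidence, ← FinHypergraph.localMatrix_map _ _ (map_zero _)]
  exact FinHypergraph.edgeMatrix_weightOfFactors _

omit hη in
theorem det_edgeVar : (I.edgeVar η).det = ∏ i, (I.vertexVar η i).det ^ H.degree i := by
  rw [edgeVar, det_blockDiagonal',
    ← Finset.prod_fiberwise' Finset.univ (fun e : H.DirEdge => FinHypergraph.tgt e)
      fun i => (I.vertexVar η i).det]
  refine Finset.prod_congr rfl fun i _ => ?_
  rw [Finset.prod_const, FinHypergraph.card_filter_tgt_eq]

theorem hessian_sum_factorTerm :
    hessian (fun y => ∑ α : H.Factor, (fun ξ => dotCLM _ (-θbar α) ξ +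
      (I.factorFamily α).legendre ξ) (y ∘ I.factorCoord α)) η =
      I.coordIncidenceᵀ * (I.allFactorVar η)⁻¹ * I.coordIncidence := by
  rw [hessian_sum_comp _ fun α => contDiffAt_factorTerm hη θbar α, inv_allFactorVar hη,
    transpose_mul_submatrix_symm_mul, factorCoord_eq_sumMap_comp, coordIncidence,
    FinHypergraph.incidence, ← pullbackMatrix_sumMap_id]
  simp only [hessian_factorTerm hη]
  rfl

theorem hessian_sum_vertexTerm :
    hessian (fun y => ∑ i, (fun ξ => (1 - (H.degree i : ℝ)) * (I.vertexFamily i).legendre ξ)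
      (y ∘ fun k => .inr ⟨i, k⟩)) η =
      fromBlocks 0 0 0 (blockDiagonal' fun i => (1 - (H.degree i : ℝ)) • (I.vertexVar η i)⁻¹) := by
  refine (hessian_sum_comp (κ := I.Coord) (fun i k => .inr ⟨i, k⟩)
    fun i => contDiffAt_vertexTerm hη i).trans ?_
  change (pullbackMatrix ℝ Sum.inr)ᵀ * blockDiagonal' (fun i => hessian _ (I.vertexPart η i)) *
    pullbackMatrix ℝ Sum.inr = _
  simp only [hessian_vertexTerm hη]
  rw [pullbackMatrix_inr, transpose_fromCols, fromRows_mul, fromRows_mul_fromCols]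
  simp

theorem hessian_betheFreeEnergy : hessian (I.betheFreeEnergy θbar) η =
    I.coordIncidenceᵀ * (I.allFactorVar η)⁻¹ * I.coordIncidence +
      fromBlocks 0 0 0
        (blockDiagonal' fun i => (1 - (H.degree i : ℝ)) • (I.vertexVar η i)⁻¹) := by
  rw [betheFreeEnergy_eq, hessian_add, hessian_sum_factorTerm hη, hessian_sum_vertexTerm hη]
  · exact ContDiffAt.sum fun α _ => contDiffAt_comp_select _ (contDiffAt_factorTerm hη θbar α)
  · exact ContDiffAt.sum fun i _ => contDiffAt_comp_select _ (contDiffAt_vertexTerm hη i)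

theorem blockDiagonal'_smul_inv_vertexVar_mul :
    (blockDiagonal' fun i => (1 - (H.degree i : ℝ)) • (I.vertexVar η i)⁻¹) *
        blockDiagonal' (I.vertexVar η) =
      1 - (H.incidence I.dimV ℝ)ᵀ * H.incidence I.dimV ℝ := by
  rw [← blockDiagonal'_mul]
  simp only [Matrix.smul_mul, nonsing_inv_mul _ (isUnit_det_vertexVar hη _),
    smul_one_eq_diagonal]
  rw [blockDiagonal'_diagonal, FinHypergraph.transpose_incidence_mul_incidence, ← diagonal_one,
    diagonal_sub]

theorem det_hessian_betheFreeEnergy :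
    (hessian (I.betheFreeEnergy θbar) η).det * (∏ i, (I.vertexVar η i).det) *
        ∏ α, (I.factorVar η α).det =
      (∏ i, (I.vertexVar η i).det ^ H.degree i) *
        (1 - ((I.edgeVar η)⁻¹ * (I.allFactorVar η).toBlocks₂₂ - 1) *
          (H.incidence I.dimV ℝ * (H.incidence I.dimV ℝ)ᵀ - 1)).det := by
  have hfactorVar : (I.allFactorVar η).det = ∏ α, (I.factorVar η α).det := by
    rw [allFactorVar, det_reindex_self, det_blockDiagonal']
  rw [hessian_betheFreeEnergy hη, ← hfactorVar, ← det_blockDiagonal', ← det_edgeVar]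
  exact det_fromBlocks_transpose_mul_inv_mul_add (isUnit_det_allFactorVar hη)
    (isUnit_det_edgeVar hη) (pullbackMatrix_sigmaBaseMap_mul_blockDiagonal' _ _)
    (blockDiagonal'_smul_inv_vertexVar_mul hη)

theorem det_one_sub_edgeMatrix_weight : (1 - (I.weight η).edgeMatrix).det =
    (((hessian (I.betheFreeEnergy θbar) η).det * (∏ α : H.Factor, (I.factorVar η α).det) *
      ∏ i : V, (I.vertexVar η i).det ^ (1 - (H.degree i : ℤ)) : ℝ) : ℂ) := by
  have hvertexVar (i : V) : (I.vertexVar η i).det ≠ 0 := (isUnit_det_vertexVar hη i).ne_zero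
  have hpow : ∏ i, (I.vertexVar η i).det ^ H.degree i ≠ 0 :=
    Finset.prod_ne_zero_iff.2 fun i _ => pow_ne_zero _ (hvertexVar i)
  have hdet := det_hessian_betheFreeEnergy hη θbar
  rw [edgeMatrix_weight hη]
  set M := ((I.edgeVar η)⁻¹ * (I.allFactorVar η).toBlocks₂₂ - 1) *
    (H.incidence I.dimV ℝ * (H.incidence I.dimV ℝ)ᵀ - 1)
  have hreal : (1 - M.map Complex.ofReal).det = ((1 - M).det : ℝ) := by
    change (1 - Complex.ofRealHom.mapMatrix M).det = Complex.ofRealHom (1 - M).det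
    rw [RingHom.map_det, map_sub, map_one]
  rw [hreal]
  congr 1
  refine mul_left_cancel₀ hpow ?_
  rw [← hdet, ← prod_pow_mul_prod_zpow_one_sub hvertexVar H.degree]
  ring

end InferenceFamily

theorem theorem4 {V : Type*} [Fintype V] [DecidableEq V] (H : FinHypergraph V)
    (X : V → Type*) [∀ i, MeasurableSpace (X i)] (I : InferenceFamily H X)
    (θbar : (α : H.Factor) → I.FactorIdx α → ℝ) :
    (∃! Z : H.Weight I.edgeDim → ℂ, H.IsReciprocalZeta I.edgeDim Z) ∧
    ∀ Z : H.Weight I.edgeDim → ℂ, H.IsReciprocalZeta I.edgeDim Z →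
      ∀ η ∈ I.localSet,
        ContDiffAt ℝ 2 (I.betheFreeEnergy θbar) η ∧
        Z (I.weight η) = (1 - (I.weight η).edgeMatrix).det ∧
        (1 - (I.weight η).edgeMatrix).det =
          (((hessian (I.betheFreeEnergy θbar) η).det *
            (∏ α : H.Factor, (I.factorVar η α).det) *
            ∏ i : V, (I.vertexVar η i).det ^ (1 - (H.degree i : ℤ)) : ℝ) : ℂ) := by
  refine ⟨⟨_, FinHypergraph.isReciprocalZeta_det H I.edgeDim, fun Z hZ => hZ.eq_det⟩, ?_⟩
  intro Z hZ η hη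
  exact ⟨InferenceFamily.contDiffAt_betheFreeEnergy hη θbar, congrFun hZ.eq_det _,
    InferenceFamily.det_one_sub_edgeMatrix_weight hη θbar⟩
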